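/- The spread of a finite simple graph is $\lambda_{\max}-\lambda_{\min}$, the difference between the largest and the smallest eigenvalue of its adjacency matrix. A graph is outerplanar if it can be drawn in the plane with no crossings such that all vertices are incident with the unbounded face. $K_1\vee F$ denotes the graph obtained from $F$ by adding one new vertex joined to every vertex of $F$, and a linear forest is a disjoint union of paths (single vertices allowed). Theorem. There exist a constant $c>0$ and an integer $N$ such that for every $n\ge N$ the following holds: if $G$ is an outerplanar graph on $n$ vertices whose spread is maximum among all outerplanar graphs on $n$ vertices, then $G$ is isomorphic to $K_1\vee F$ for some linear forest $F$ on $n-1$ vertices with at least $c\,n$ edges. -/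

import Mathlib

namespace OuterplanarSpread

/-- The Euclidean plane. -/
abbrev Plane : Type := EuclideanSpace ℝ (Fin 2)

/-- A drawing of the simple graph `G` in the plane without crossings: vertices are distinct points,
the edge `uv` is a simple arc joining the points of `u` and `v`, an edge passes through no vertex
other than its ends, and two distinct edges meet at most in a common end. -/
structure PlaneDrawing {V : Type*} (G : SimpleGraph V) where
  /-- the point that represents a vertex -/
  pos : V → Plane
  pos_injective : Function.Injective pos
  /-- the point set that represents an edge (only the values at edges of `G` matter) -/
  arc : Sym2 V → Set Plane
  isArc : ∀ u v : V, G.Adj u v →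
    ∃ γ : Path (pos u) (pos v), Function.Injective γ ∧ Set.range γ = arc s(u, v)
  vertex_of_mem_arc : ∀ e ∈ G.edgeSet, ∀ v : V, pos v ∈ arc e → v ∈ e
  common_end : ∀ e ∈ G.edgeSet, ∀ f ∈ G.edgeSet, e ≠ f →
    ∀ p ∈ arc e ∩ arc f, ∃ v : V, v ∈ e ∧ v ∈ f ∧ pos v = p

/-- The set of all points of the plane covered by a drawing. -/
def PlaneDrawing.image {V : Type*} {G : SimpleGraph V} (D : PlaneDrawing G) : Set Plane :=
  Set.range D.pos ∪ ⋃ e ∈ G.edgeSet, D.arc e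

/-- The unbounded face: the points off the drawing whose connected component in the complement of
the drawing is unbounded. -/
def PlaneDrawing.outerFace {V : Type*} {G : SimpleGraph V} (D : PlaneDrawing G) : Set Plane :=
  {p | p ∈ D.imageᶜ ∧ ¬ Bornology.IsBounded (connectedComponentIn D.imageᶜ p)}

/-- A graph is outerplanar if it can be drawn in the plane without crossings so that all vertices
are incident with (lie on the boundary of) the unbounded face. -/
def IsOuterplanar {V : Type*} (G : SimpleGraph V) : Prop :=
  ∃ D : PlaneDrawing G, ∀ v : V, D.pos v ∈ frontier D.outerFace

open Classical in
theorem isHermitian_adjMatrix {V : Type*} (G : SimpleGraph V) :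
    (G.adjMatrix ℝ).IsHermitian := by
  rw [Matrix.IsHermitian, Matrix.conjTranspose_eq_transpose_of_trivial]
  exact G.isSymm_adjMatrix

open Classical in
/-- The spread of a graph: the largest minus the smallest eigenvalue of its adjacency matrix. -/
noncomputable def spread {V : Type*} [Fintype V] (G : SimpleGraph V) : ℝ :=
  (⨆ i, (isHermitian_adjMatrix G).eigenvalues i) - ⨅ i, (isHermitian_adjMatrix G).eigenvalues i

/-- The join of two graphs: their disjoint union together with all edges between the two parts. -/
def join {V W : Type*} (G : SimpleGraph V) (H : SimpleGraph W) : SimpleGraph (V ⊕ W) :=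
  (G ⊕g H) ⊔ completeBipartiteGraph V W

/-- A linear forest is a disjoint union of paths: each connected component is a path `P_k`. -/
def IsLinearForest {V : Type*} (F : SimpleGraph V) : Prop :=
  ∀ C : F.ConnectedComponent, ∃ k : ℕ, Nonempty (C.toSimpleGraph ≃g SimpleGraph.pathGraph k)

/-- `G` maximizes the spread over all outerplanar graphs on `n` vertices. -/
def IsSpreadExtremal {n : ℕ} (G : SimpleGraph (Fin n)) : Prop :=
  IsOuterplanar G ∧ ∀ H : SimpleGraph (Fin n), IsOuterplanar H → spread H ≤ spread G

end OuterplanarSpread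

namespace OuterplanarSpread

open Set Topology Bornology

/-! Let s = √n, and let ρ₁, ρ₂ be the largest eigenvalues of A and -A, so that the spread is ρ₁ + ρ₂
(`exists_topEigenvalues`).

Topology serves only to exclude K₄ and configurations that contract to K_{2,3}. For compact K and p
off K, the function z - p has a continuous logarithm on K exactly when p lies in an unbounded
component of the complement (`hasLogOn_of_mem_outerPart`, `not_hasLogOn_of_mem_innerPart`), and
logarithms glue along connected intersections. This gives `theta_not_outer` and
`false_of_isClique_four`. Hence two vertices of an outerplanar graph have at most two common
neighbours, the number of edges is linear (`IsOuterplanar.isSparse`), and every neighbourhood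
induces a linear forest (`IsOuterplanar.exists_line_order_link`). Conversely `isOuterplanar_of_fan`
draws a vertex joined to a linear forest.

The fan over a path has spread at least 2√(n-1) + 1/(2√(n-1)) (`le_spread_fanGraph`), while sparsity
gives ρ₁, ρ₂ ≤ s + 6. In an extremal graph both are therefore s + O(1), and the largest entry of
each eigenvector sits at a vertex adjacent to all but O(s) vertices. There is only one such hub x.
Vertices not adjacent to x carry entries O(1/s²), so deleting their edges and joining them to x
raises both eigenvalues (`IsHub.lt_of_isTopEigenvalue_hubClosure`) and stays outerplanar. Thus x
dominates, and the rest is a linear forest F.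

With M twice the number of edges of F, `IsHub.exists_sq_eq` gives ρᵢ² = n - 1 + Tᵢ, where ρ₁T₁ = M
and ρ₂T₂ = -M up to errors O(M/s). The comparison with the fan forces T₁ + T₂ ≥ 1. The main terms
cancel, so ρ₂ = O(M/s), which means M is at least a constant times n (`IsHub.card_le_adjForm`). -/

/-! ### Continuous logarithms on plane sets -/

/-- `f` has a continuous logarithm on `K`. -/
def HasLogOn (f : ℂ → ℂ) (K : Set ℂ) : Prop :=
  ∃ L : ℂ → ℂ, ContinuousOn L K ∧ ∀ z ∈ K, Complex.exp (L z) = f z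

theorem HasLogOn.mono {f : ℂ → ℂ} {K K' : Set ℂ} (h : HasLogOn f K) (hK : K' ⊆ K) :
    HasLogOn f K' := by
  obtain ⟨L, hL, hf⟩ := h
  exact ⟨L, hL.mono hK, fun z hz => hf z (hK hz)⟩

/-- The difference of two logarithms takes values in the discrete group 2πiℤ, hence is constant on a
preconnected set. -/
theorem exists_eq_add_of_exp_eq {X : Type*} [TopologicalSpace X] {S : Set X}
    (hS : IsPreconnected S) {L M : X → ℂ} (hL : ContinuousOn L S) (hM : ContinuousOn M S)
    (h : ∀ x ∈ S, Complex.exp (L x) = Complex.exp (M x)) :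
    ∃ c : ℂ, Complex.exp c = 1 ∧ ∀ x ∈ S, L x = M x + c := by
  have hd : DiscreteTopology (AddSubgroup.zmultiples (2 * Real.pi * Complex.I) : Set ℂ) :=
    NormedSpace.discreteTopology_zmultiples _
  obtain ⟨c, hc, hc'⟩ := hS.eqOn_const_of_mapsTo
    (T := (AddSubgroup.zmultiples (2 * Real.pi * Complex.I) : Set ℂ))
    ⟨hd⟩ (hL.sub hM) (by
      intro x hx
      obtain ⟨n, hn⟩ := Complex.exp_eq_exp_iff_exists_int.1 (h x hx)
      exact ⟨n, by simp [hn]⟩) ⟨0, by simp⟩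
  refine ⟨c, ?_, fun x hx => ?_⟩
  · obtain ⟨n, rfl⟩ := hc
    rw [Complex.exp_eq_one_iff]
    exact ⟨n, by simp⟩
  · have := hc' hx
    simp only [Pi.sub_apply, Function.const_apply] at this
    rw [← this]; ring

/-- On the connected intersection the two logarithms differ by a period, and shifting one of them by
it makes them agree there. -/
theorem HasLogOn.union_of_isClosed {f : ℂ → ℂ} {K₁ K₂ : Set ℂ} (h₁ : IsClosed K₁)
    (h₂ : IsClosed K₂) (hc : IsPreconnected (K₁ ∩ K₂)) (hf₁ : HasLogOn f K₁)
    (hf₂ : HasLogOn f K₂) : HasLogOn f (K₁ ∪ K₂) := by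
  classical
  obtain ⟨L, hL, hLf⟩ := hf₁
  obtain ⟨M, hM, hMf⟩ := hf₂
  obtain ⟨c, hc1, hc2⟩ := exists_eq_add_of_exp_eq hc (hL.mono inter_subset_left)
    (hM.mono inter_subset_right) (fun x hx => by rw [hLf x hx.1, hMf x hx.2])
  let P : ℂ → ℂ := fun z => if z ∈ K₁ then L z else M z + c
  have e1 : EqOn P L K₁ := fun z hz => if_pos hz
  have e2 : EqOn P (fun z => M z + c) K₂ := by
    intro z hz
    by_cases h : z ∈ K₁
    · simp [P, h, hc2 z ⟨h, hz⟩]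
    · simp [P, h]
  refine ⟨P, ContinuousOn.union_of_isClosed (hL.congr e1)
    ((hM.add continuousOn_const).congr e2) h₁ h₂, ?_⟩
  rintro z (hz | hz)
  · rw [e1 hz, hLf z hz]
  · rw [e2 hz, Complex.exp_add, hc1, mul_one, hMf z hz]

theorem HasLogOn.union_of_isOpen {f : ℂ → ℂ} {K₁ K₂ : Set ℂ} (h₁ : IsOpen K₁)
    (h₂ : IsOpen K₂) (hc : IsPreconnected (K₁ ∩ K₂)) (hf₁ : HasLogOn f K₁)
    (hf₂ : HasLogOn f K₂) : HasLogOn f (K₁ ∪ K₂) := by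
  classical
  obtain ⟨L, hL, hLf⟩ := hf₁
  obtain ⟨M, hM, hMf⟩ := hf₂
  obtain ⟨c, hc1, hc2⟩ := exists_eq_add_of_exp_eq hc (hL.mono inter_subset_left)
    (hM.mono inter_subset_right) (fun x hx => by rw [hLf x hx.1, hMf x hx.2])
  let P : ℂ → ℂ := fun z => if z ∈ K₁ then L z else M z + c
  have e1 : EqOn P L K₁ := fun z hz => if_pos hz
  have e2 : EqOn P (fun z => M z + c) K₂ := by
    intro z hz
    by_cases h : z ∈ K₁
    · simp [P, h, hc2 z ⟨h, hz⟩]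
    · simp [P, h]
  refine ⟨P, ContinuousOn.union_of_isOpen (hL.congr e1)
    ((hM.add continuousOn_const).congr e2) h₁ h₂, ?_⟩
  rintro z (hz | hz)
  · rw [e1 hz, hLf z hz]
  · rw [e2 hz, Complex.exp_add, hc1, mul_one, hMf z hz]

/-- Homotopy lifting for the exponential map, on a subset of the plane. -/
theorem HasLogOn.of_homotopy {K : Set ℂ} (h : unitInterval → ℂ → ℂ)
    (hc : ContinuousOn (fun q : unitInterval × ℂ => h q.1 q.2) (univ ×ˢ K))
    (h0 : ∀ t, ∀ z ∈ K, h t z ≠ 0) (hl : HasLogOn (h 0) K) : HasLogOn (h 1) K := by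
  obtain ⟨L, hL, hLf⟩ := hl
  let H : C(unitInterval × K, {z : ℂ // z ≠ 0}) :=
    ⟨fun q => ⟨h q.1 q.2, h0 _ _ q.2.2⟩, by
      refine Continuous.subtype_mk ?_ _
      exact hc.comp_continuous (f := fun q : unitInterval × K => (q.1, (q.2 : ℂ))) (by fun_prop)
        (fun q => ⟨mem_univ _, q.2.2⟩)⟩
  let f : C(K, ℂ) := ⟨fun z => L z, hL.domRestrict⟩
  have H0 : ∀ a, H (0, a) = ⟨Complex.exp (f a), Complex.exp_ne_zero _⟩ := fun a =>
    Subtype.ext (hLf a a.2).symm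
  let Γ := Complex.isCoveringMap_exp.liftHomotopy H f H0
  have hΓ := Complex.isCoveringMap_exp.liftHomotopy_lifts H f H0
  classical
  refine ⟨fun z => if hz : z ∈ K then Γ (1, ⟨z, hz⟩) else 0, ?_, fun z hz => ?_⟩
  · rw [continuousOn_iff_continuous_domRestrict]
    have : K.domRestrict (fun z => if hz : z ∈ K then Γ (1, ⟨z, hz⟩) else 0) =
        fun z : K => Γ (1, z) := by
      ext z; simp [domRestrict_apply]
    rw [this]
    fun_prop
  · have := congrArg Subtype.val (congrFun hΓ (1, ⟨z, hz⟩))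
    simp only [hz, dite_true]
    exact this

/-- Pulled back along the angle, a logarithm must be log r + iθ up to a constant, which takes
different values at 0 and 2π. -/
theorem not_hasLogOn_sphere (p : ℂ) {r : ℝ} (hr : 0 < r) :
    ¬ HasLogOn (fun z => z - p) (Metric.sphere p r) := by
  rintro ⟨L, hL, hLf⟩
  have hmem : ∀ θ : ℝ, circleMap p r θ ∈ Metric.sphere p r := fun θ =>
    circleMap_mem_sphere p hr.le θ
  have hcont : Continuous fun θ : ℝ => L (circleMap p r θ) :=
    hL.comp_continuous (continuous_circleMap p r) hmem
  obtain ⟨c, -, hc⟩ := exists_eq_add_of_exp_eq (S := (univ : Set ℝ)) isPreconnected_univ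
    (L := fun θ : ℝ => L (circleMap p r θ))
    (M := fun θ : ℝ => Complex.log r + θ * Complex.I) hcont.continuousOn
    (by fun_prop) (fun θ _ => by
      rw [hLf _ (hmem θ), Complex.exp_add, Complex.exp_log (by exact_mod_cast hr.ne')]
      simp [circleMap])
  have h0 := hc 0 trivial
  have h1 := hc (2 * Real.pi) trivial
  have h2 : circleMap p r (2 * Real.pi) = circleMap p r 0 := by
    simpa using (periodic_circleMap p r) 0
  simp only [h2, h0] at h1
  have : (2 * Real.pi * Complex.I : ℂ) = 0 := by
    push_cast at h1
    linear_combination -h1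
  simp [Real.pi_ne_zero] at this

/-! ### Outer and inner parts of the complement -/

/-- Points off `K` in an unbounded component of the complement of `K`. -/
def outerPart (K : Set ℂ) : Set ℂ :=
  {p | p ∈ Kᶜ ∧ ¬ IsBounded (connectedComponentIn Kᶜ p)}

/-- Points off `K` in a bounded component of the complement of `K`. -/
def innerPart (K : Set ℂ) : Set ℂ :=
  {p | p ∈ Kᶜ ∧ IsBounded (connectedComponentIn Kᶜ p)}

theorem mem_outerPart_or_mem_innerPart {K : Set ℂ} {p : ℂ} (hp : p ∉ K) :
    p ∈ outerPart K ∨ p ∈ innerPart K := by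
  by_cases h : IsBounded (connectedComponentIn Kᶜ p)
  · exact Or.inr ⟨hp, h⟩
  · exact Or.inl ⟨hp, h⟩

theorem outerPart_anti {K K' : Set ℂ} (h : K ⊆ K') : outerPart K' ⊆ outerPart K := by
  rintro p ⟨hp, hb⟩
  refine ⟨fun h' => hp (h h'), fun h' => hb (h'.subset ?_)⟩
  exact connectedComponentIn_mono _ (compl_subset_compl.2 h)

theorem mem_outerPart_of_isPreconnected {K S : Set ℂ} (hS : IsPreconnected S) (hK : Disjoint S K)
    {p q : ℂ} (hp : p ∈ S) (hq : q ∈ S) (h : p ∈ outerPart K) : q ∈ outerPart K := by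
  have hSK : S ⊆ Kᶜ := fun z hz hz' => disjoint_left.1 hK hz hz'
  refine ⟨hSK hq, ?_⟩
  rw [← connectedComponentIn_eq (hS.subset_connectedComponentIn hp hSK hq)]
  exact h.2

theorem mem_outerPart_of_mem_closure {K : Set ℂ} (hK : IsClosed K) {p : ℂ} (hp : p ∉ K)
    (h : p ∈ closure (outerPart K)) : p ∈ outerPart K := by
  have hopen : IsOpen (connectedComponentIn Kᶜ p) := hK.isOpen_compl.connectedComponentIn
  obtain ⟨q, hq, hq'⟩ := mem_closure_iff.1 h _ hopen (mem_connectedComponentIn hp)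
  refine ⟨hp, ?_⟩
  rw [connectedComponentIn_eq hq]
  exact hq'.2

theorem frontier_connectedComponentIn_compl_subset {K : Set ℂ} (hK : IsClosed K) (p : ℂ) :
    frontier (connectedComponentIn Kᶜ p) ⊆ K := by
  intro z hz
  by_contra hzK
  have hW : IsOpen (connectedComponentIn Kᶜ p) := hK.isOpen_compl.connectedComponentIn
  have hopen : IsOpen (connectedComponentIn Kᶜ z) := hK.isOpen_compl.connectedComponentIn
  obtain ⟨q, hq, hq'⟩ := mem_closure_iff.1 hz.1 _ hopen (mem_connectedComponentIn hzK)
  have : z ∈ connectedComponentIn Kᶜ p := by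
    rw [connectedComponentIn_eq hq', ← connectedComponentIn_eq hq]
    exact mem_connectedComponentIn hzK
  exact hz.2 (by rwa [hW.interior_eq])

/-- Slide p inside its component to a point q farther from the origin than all of K. There 1 - z/q
stays in the slit plane, so z - q has a logarithm; homotopy lifting brings it back to p. -/
theorem hasLogOn_of_mem_outerPart {K : Set ℂ} (hK : IsCompact K) {p : ℂ} (hp : p ∈ outerPart K) :
    HasLogOn (fun z => z - p) K := by
  obtain ⟨R, hR⟩ := hK.isBounded.subset_ball (0 : ℂ)
  have hW : IsOpen (connectedComponentIn Kᶜ p) := hK.isClosed.isOpen_compl.connectedComponentIn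
  have hconn : IsConnected (connectedComponentIn Kᶜ p) :=
    isConnected_connectedComponentIn_iff.2 hp.1
  obtain ⟨q, hq, hqR⟩ : ∃ q ∈ connectedComponentIn Kᶜ p, q ∉ Metric.ball (0 : ℂ) (max R 1) := by
    by_contra! h
    exact hp.2 (Metric.isBounded_ball.subset h)
  have hqR' : max R 1 ≤ ‖q‖ := by simpa using hqR
  have hq0 : 0 < ‖q‖ := by have := le_max_right R 1; linarith
  have hqne : q ≠ 0 := norm_pos_iff.1 hq0
  obtain ⟨γ, hγ⟩ := (hW.isConnected_iff_isPathConnected.1 hconn).joinedIn q hq p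
    (mem_connectedComponentIn hp.1)
  have hlog : HasLogOn (fun z => z - q) K := by
    have hlt : ∀ z ∈ K, 1 + -z / q ∈ Complex.slitPlane := by
      intro z hz
      apply Complex.mem_slitPlane_of_norm_lt_one
      rw [norm_div, norm_neg, div_lt_one hq0]
      have := hR hz
      simp only [Metric.mem_ball, dist_zero_right] at this
      linarith [le_max_left R 1]
    refine ⟨fun z => Complex.log (1 + -z / q) + Complex.log (-q), ?_, fun z hz => ?_⟩
    · refine ContinuousOn.add (ContinuousOn.clog (by fun_prop) hlt) continuousOn_const
    · rw [Complex.exp_add, Complex.exp_log (Complex.slitPlane_ne_zero (hlt z hz)),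
        Complex.exp_log (neg_ne_zero.2 hqne)]
      field_simp
      ring
  have := HasLogOn.of_homotopy (K := K) (fun t z => z - γ t) (by fun_prop) (fun t z hz h => by
    have h1 : γ t ∈ Kᶜ := connectedComponentIn_subset _ _ (hγ t)
    rw [sub_eq_zero] at h
    exact h1 (h ▸ hz)) (by simpa using hlog)
  simpa using this

/-- Borsuk's argument: extend the logarithm by Tietze and replace z - p by its exponential inside
the bounded component W of p. The result is continuous and zero-free on the whole plane, so it has a
logarithm, yet it equals z - p on a large circle. -/
theorem not_hasLogOn_of_mem_innerPart {K : Set ℂ} (hK : IsCompact K) {p : ℂ}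
    (hp : p ∈ innerPart K) : ¬ HasLogOn (fun z => z - p) K := by
  rintro ⟨L, hL, hLf⟩
  set W := connectedComponentIn Kᶜ p with hWdef
  have hpW : p ∈ W := mem_connectedComponentIn hp.1
  obtain ⟨φ, hφ⟩ := ContinuousMap.exists_restrict_eq hK.isClosed (⟨_, hL.domRestrict⟩ : C(K, ℂ))
  have hφK : ∀ z ∈ K, φ z = L z := fun z hz => congrArg (fun f => f ⟨z, hz⟩) hφ
  obtain ⟨R, hR⟩ := hp.2.subset_ball p
  have hR0 : 0 < R := by simpa using hR hpW
  classical
  let F : ℂ → ℂ := W.piecewise (fun z => Complex.exp (φ z)) (fun z => z - p)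
  have hF : Continuous F := by
    refine Continuous.piecewise (fun z hz => ?_) (by fun_prop) (by fun_prop)
    have hzK := frontier_connectedComponentIn_compl_subset hK.isClosed p hz
    rw [hφK z hzK, hLf z hzK]
  have hF0 : ∀ z, F z ≠ 0 := by
    intro z
    by_cases hz : z ∈ W
    · simp only [F, piecewise_eq_of_mem _ _ _ hz]; exact Complex.exp_ne_zero _
    · simp only [F, piecewise_eq_of_notMem _ _ _ hz]
      rw [sub_ne_zero]
      rintro rfl
      exact hz hpW
  have := HasLogOn.of_homotopy (K := univ) (fun t z => F (p + (t : ℝ) * (z - p))) (by fun_prop)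
    (fun t z _ => hF0 _) ⟨fun _ => Complex.log (F p), continuousOn_const, fun z _ => by
      rw [Complex.exp_log (hF0 p)]; simp⟩
  obtain ⟨M, hM, hMf⟩ := this
  refine not_hasLogOn_sphere p hR0 ⟨M, hM.mono (subset_univ _), fun z hz => ?_⟩
  rw [hMf z trivial]
  have hz' : z ∉ W := fun h => by
    have h1 := hR h
    simp only [Metric.mem_ball] at h1
    rw [Metric.mem_sphere] at hz
    linarith
  simp [F, piecewise_eq_of_notMem _ _ _ hz']

theorem isPreconnected_compl_closedBall (R : ℝ) :
    IsPreconnected ((Metric.closedBall (0 : ℂ) R)ᶜ) := by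
  -- Polar coordinates; radius 0 must be admitted only for negative R, where the ball is empty.
  have h : (Metric.closedBall (0 : ℂ) R)ᶜ =
      (fun q : ℝ × ℝ => (q.1 : ℂ) * Complex.exp (q.2 * Complex.I)) ''
        ((Ioi (max R 0) ∪ {q | q = 0 ∧ R < 0}) ×ˢ univ) := by
    ext z
    constructor
    · intro hz
      have hz' : R < ‖z‖ := by simpa using hz
      refine ⟨(‖z‖, z.arg), ⟨?_, trivial⟩, Complex.norm_mul_exp_arg_mul_I z⟩
      rcases (norm_nonneg z).eq_or_lt with h | h
      · exact Or.inr ⟨h.symm, h ▸ hz'⟩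
      · exact Or.inl (max_lt hz' h)
    · rintro ⟨⟨r, θ⟩, ⟨hr, -⟩, rfl⟩
      simp only [mem_compl_iff, Metric.mem_closedBall, dist_zero_right, norm_mul,
        Complex.norm_exp_ofReal_mul_I, mul_one, Complex.norm_real, not_le, Real.norm_eq_abs]
      rcases hr with hr | ⟨rfl, hr⟩
      · exact lt_of_lt_of_le ((le_max_left _ _).trans_lt hr) (le_abs_self r)
      · simpa using hr
  rw [h]
  refine IsPreconnected.image ?_ _ (by fun_prop)
  refine IsPreconnected.prod ?_ isPreconnected_univ
  by_cases hR : R < 0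
  · have : Ioi (max R 0) ∪ {q | q = 0 ∧ R < 0} = Ici (0 : ℝ) := by
      ext q
      simp only [hR, and_true, max_eq_right hR.le, mem_union, mem_Ioi, mem_ofPred_eq, mem_Ici]
      rw [le_iff_lt_or_eq, eq_comm (a := q)]
    rw [this]; exact isPreconnected_Ici
  · have : Ioi (max R 0) ∪ {q | q = 0 ∧ R < 0} = Ioi (max R 0) := by simp [hR]
    rw [this]; exact isPreconnected_Ioi

/-- Every component is unbounded and so meets the connected exterior of a disc containing K. -/
theorem isPreconnected_compl_of_innerPart_eq_empty {K : Set ℂ} (hK : IsCompact K)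
    (h : innerPart K = ∅) : IsPreconnected Kᶜ := by
  obtain ⟨R, hR⟩ := hK.isBounded.subset_closedBall (0 : ℂ)
  have hfar : ∃ q : ℂ, q ∈ (Metric.closedBall (0 : ℂ) R)ᶜ :=
    ⟨(|R| + 1 : ℝ), by
      simp only [mem_compl_iff, Metric.mem_closedBall, dist_zero_right, Complex.norm_real, not_le,
        Real.norm_eq_abs]
      rw [abs_of_pos (by positivity)]
      linarith [le_abs_self R]⟩
  obtain ⟨q, hq⟩ := hfar
  refine isPreconnected_of_forall q fun p hp => ⟨connectedComponentIn Kᶜ p ∪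
    (Metric.closedBall (0 : ℂ) R)ᶜ, union_subset (connectedComponentIn_subset _ _)
    (compl_subset_compl.2 hR), Or.inr hq, Or.inl (mem_connectedComponentIn hp), ?_⟩
  have hp' : p ∈ outerPart K := (mem_outerPart_or_mem_innerPart hp).resolve_right (by simp [h])
  obtain ⟨x, hx, hxR⟩ : ∃ x ∈ connectedComponentIn Kᶜ p, x ∉ Metric.closedBall (0 : ℂ) R := by
    by_contra! h
    exact hp'.2 (Metric.isBounded_closedBall.subset h)
  exact IsPreconnected.union x hx hxR isPreconnected_connectedComponentIn
    (isPreconnected_compl_closedBall R)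

/-- Moving the zero c back to the pole a along a path in X deforms the quotient to the constant 1
without zeros off X. -/
theorem hasLogOn_div_compl {X : Set ℂ} {a c : ℂ} (h : JoinedIn X a c) :
    HasLogOn (fun z => (z - c) / (z - a)) Xᶜ := by
  obtain ⟨γ, hγ⟩ := h
  have ha : a ∈ X := by simpa using hγ 0
  have h1 : ∀ z ∈ Xᶜ, z - a ≠ 0 := fun z hz h => hz (by rwa [sub_eq_zero.1 h])
  have := HasLogOn.of_homotopy (K := Xᶜ) (fun t z => (z - γ t) / (z - a))
    (ContinuousOn.div (by fun_prop) (by fun_prop) fun q hq => h1 q.2 hq.2)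
    (fun t z hz => div_ne_zero (fun h => hz (by rw [sub_eq_zero.1 h]; exact hγ t)) (h1 z hz))
    ⟨fun _ => 0, continuousOn_const, fun z hz => by simp [div_self (h1 z hz)]⟩
  simpa using this

/-- The union of two connections between `a` and `c` that meet only in `a` and `c` separates
the plane. -/
theorem innerPart_union_nonempty {X Y : Set ℂ} {a c : ℂ} (hX : IsCompact X) (hY : IsCompact Y)
    (hac : a ≠ c) (hXY : X ∩ Y = {a, c}) (hjX : JoinedIn X a c) (hjY : JoinedIn Y a c) :
    (innerPart (X ∪ Y)).Nonempty := by
  by_contra hne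
  rw [not_nonempty_iff_eq_empty] at hne
  have hcon := isPreconnected_compl_of_innerPart_eq_empty (hX.union hY) hne
  rw [compl_union] at hcon
  -- If the complement of `X ∪ Y` were connected, the quotient (z - c)/(z - a) would have a
  -- logarithm off {a, c}. On a circle around a that leaves c outside, z - c has one too, hence so
  -- would z - a.
  have hlog := HasLogOn.union_of_isOpen hX.isClosed.isOpen_compl hY.isClosed.isOpen_compl hcon
    (hasLogOn_div_compl hjX) (hasLogOn_div_compl hjY)
  rw [← compl_inter, hXY] at hlog
  have hr : 0 < dist a c / 2 := by have := dist_pos.2 hac; linarith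
  have hcA : ∀ z ∈ Metric.sphere a (dist a c / 2), z ≠ c ∧ z ≠ a := by
    intro z hz
    rw [Metric.mem_sphere] at hz
    constructor
    · rintro rfl; rw [dist_comm] at hz; linarith
    · rintro rfl; rw [dist_self] at hz; linarith
  obtain ⟨M, hM, hMf⟩ := hlog.mono (K' := Metric.sphere a (dist a c / 2)) (fun z hz => by
    simp [(hcA z hz).1, (hcA z hz).2])
  have hcS : c ∈ outerPart (Metric.sphere a (dist a c / 2)) := by
    have hS : IsPreconnected {z : ℂ | dist a c / 2 < dist z a} := by
      have := (isPreconnected_compl_closedBall (dist a c / 2)).image (fun z => z + a)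
        (by fun_prop)
      convert this using 1
      ext z
      simp only [mem_ofPred_eq, mem_image, mem_compl_iff, Metric.mem_closedBall, dist_zero_right,
        not_le]
      constructor
      · intro h; exact ⟨z - a, by rwa [← dist_eq_norm], by ring⟩
      · rintro ⟨w, hw, rfl⟩; simpa [dist_eq_norm] using hw
    have hsub : {z : ℂ | dist a c / 2 < dist z a} ⊆ (Metric.sphere a (dist a c / 2))ᶜ := by
      intro z hz hz'
      rw [Metric.mem_sphere] at hz'
      exact absurd hz' (ne_of_gt hz)
    have hcm : c ∈ {z : ℂ | dist a c / 2 < dist z a} := by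
      simp only [mem_ofPred_eq]; rw [dist_comm c a]; linarith
    refine ⟨hsub hcm, fun hb => ?_⟩
    have hb' := hb.subset (hS.subset_connectedComponentIn hcm hsub)
    obtain ⟨R, hR⟩ := hb'.subset_ball a
    have h1 : (a + ((|R| + dist a c : ℝ) : ℂ)) ∈ {z : ℂ | dist a c / 2 < dist z a} := by
      simp only [mem_ofPred_eq, dist_eq_norm, add_sub_cancel_left, Complex.norm_real,
        Real.norm_eq_abs]
      rw [abs_of_nonneg (by positivity)]
      have := abs_nonneg R
      rw [dist_eq_norm] at hr
      linarith
    have h2 := hR h1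
    simp only [Metric.mem_ball, dist_eq_norm, add_sub_cancel_left, Complex.norm_real,
        Real.norm_eq_abs] at h2
    rw [abs_of_nonneg (by positivity)] at h2
    have := le_abs_self R
    have := norm_nonneg (a - c)
    linarith
  obtain ⟨N, hN, hNf⟩ := hasLogOn_of_mem_outerPart (isCompact_sphere _ _) hcS
  refine not_hasLogOn_sphere a hr ⟨fun z => N z - M z, hN.sub hM, fun z hz => ?_⟩
  have h1 := sub_ne_zero.2 (hcA z hz).1
  have h2 := sub_ne_zero.2 (hcA z hz).2
  rw [Complex.exp_sub, hNf z hz, hMf z hz]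
  field_simp

/-- The bounded component of p off one set cannot meet the other, so both sets give the same
component W. Its frontier lies in both sets, so W is also the component of p off the intersection.
-/
theorem mem_innerPart_inter {K₁ K₂ : Set ℂ} (h₁ : IsClosed K₁) (h₂ : IsClosed K₂)
    (h₂₁ : K₂ \ K₁ ⊆ outerPart K₁) (h₁₂ : K₁ \ K₂ ⊆ outerPart K₂) {p : ℂ}
    (hp₁ : p ∈ innerPart K₁) (hp₂ : p ∈ innerPart K₂) : p ∈ innerPart (K₁ ∩ K₂) := by
  have key : ∀ {K K' : Set ℂ}, K' \ K ⊆ outerPart K → p ∈ innerPart K → p ∈ innerPart K' →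
      connectedComponentIn Kᶜ p ⊆ connectedComponentIn K'ᶜ p := by
    intro K K' h hp hp'
    refine isPreconnected_connectedComponentIn.subset_connectedComponentIn
      (mem_connectedComponentIn hp.1) fun z hz hz' => ?_
    have h1 := h ⟨hz', connectedComponentIn_subset _ _ hz⟩
    exact h1.2 (connectedComponentIn_eq hz ▸ hp.2)
  have e : connectedComponentIn K₁ᶜ p = connectedComponentIn K₂ᶜ p :=
    (key h₂₁ hp₁ hp₂).antisymm (key h₁₂ hp₂ hp₁)
  set W := connectedComponentIn K₁ᶜ p with hW
  refine ⟨fun h => hp₁.1 h.1, hp₁.2.subset ?_⟩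
  intro z hz
  by_contra hzW
  have hWo : IsOpen W := h₁.isOpen_compl.connectedComponentIn
  have hcl : ∀ x ∈ connectedComponentIn (K₁ ∩ K₂)ᶜ p, x ∈ closure W → x ∈ W := by
    intro x hx hxc
    by_contra hxW
    have hfr : x ∈ frontier W := ⟨hxc, by rwa [hWo.interior_eq]⟩
    exact connectedComponentIn_subset _ _ hx
      ⟨frontier_connectedComponentIn_compl_subset h₁ p hfr,
        frontier_connectedComponentIn_compl_subset h₂ p (e ▸ hfr)⟩
  obtain ⟨x, -, hxW, hxW'⟩ := (isPreconnected_connectedComponentIn (F := (K₁ ∩ K₂)ᶜ) (x := p))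
    W (closure W)ᶜ hWo isClosed_closure.isOpen_compl
    (fun x hx => by
      by_cases h : x ∈ closure W
      · exact Or.inl (hcl x hx h)
      · exact Or.inr h)
    ⟨p, mem_connectedComponentIn fun h => hp₁.1 h.1, mem_connectedComponentIn hp₁.1⟩
    ⟨z, hz, fun h => hzW (hcl z hz h)⟩
  exact hxW' (subset_closure hxW)

/-- Lift f ∘ γ through exp on the unit interval and transport the lift by the inverse of γ, a
homeomorphism onto the arc. -/
theorem hasLogOn_range_of_injective {u v : ℂ} (γ : Path u v) (hγ : Function.Injective γ)
    {f : ℂ → ℂ} (hf : ContinuousOn f (range γ)) (h0 : ∀ z ∈ range γ, f z ≠ 0) :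
    HasLogOn f (range γ) := by
  have hemb : IsClosedEmbedding γ := γ.continuous.isClosedEmbedding hγ
  let g : C(unitInterval, {z : ℂ // z ≠ 0}) := ⟨fun t => ⟨f (γ t), h0 _ (mem_range_self t)⟩,
    Continuous.subtype_mk (hf.comp_continuous γ.continuous mem_range_self) _⟩
  obtain ⟨Γ, hΓ, -⟩ := Complex.isCoveringMap_exp.exists_path_lifts g (Complex.log (f (γ 0)))
    (Subtype.ext (Complex.exp_log (h0 _ (mem_range_self 0))).symm)
  have hinv : ∀ t, Function.invFun γ (γ t) = t := Function.leftInverse_invFun hγ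
  refine ⟨fun z => Γ (Function.invFun γ z), ?_, ?_⟩
  · rw [continuousOn_iff_continuous_domRestrict]
    let e := hemb.isEmbedding.toHomeomorph
    have : (range γ).domRestrict (fun z => Γ (Function.invFun γ z)) = fun z => Γ (e.symm z) := by
      ext z
      obtain ⟨t, rfl⟩ := e.surjective z
      simp only [domRestrict_apply, Homeomorph.symm_apply_apply]
      exact congrArg Γ (hinv t)
    rw [this]
    fun_prop
  · rintro _ ⟨t, rfl⟩
    simp only [hinv]
    exact congrArg Subtype.val (congrFun hΓ t)

end OuterplanarSpread

/-! ### Theta curves, and forbidden configurations in outerplanar drawings. -/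

namespace OuterplanarSpread

open Set Topology Bornology

theorem disjoint_innerPart_outerPart {K : Set ℂ} {p : ℂ} (h : p ∈ innerPart K) :
    p ∉ outerPart K := fun h' => h'.2 h.2

/-- Three connections between two points that meet only in these two points cannot all be
accessible from the unbounded face. -/
theorem theta_not_outer {X₁ X₂ X₃ : Set ℂ} {a c : ℂ} (hac : a ≠ c)
    (hX₁ : IsCompact X₁) (hX₂ : IsCompact X₂) (hX₃ : IsCompact X₃)
    (hj₁ : JoinedIn X₁ a c) (hj₂ : JoinedIn X₂ a c) (hX₃p : IsPreconnected X₃)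
    (hl₁ : ∀ p ∉ X₁, HasLogOn (fun z => z - p) X₁) (hl₂ : ∀ p ∉ X₂, HasLogOn (fun z => z - p) X₂)
    (h₁₂ : X₁ ∩ X₂ = {a, c}) (h₁₃ : X₁ ∩ X₃ = {a, c}) (h₂₃ : X₂ ∩ X₃ = {a, c})
    (ho₁ : X₁ \ (X₂ ∪ X₃) ⊆ outerPart (X₂ ∪ X₃)) (ho₂ : X₂ \ (X₁ ∪ X₃) ⊆ outerPart (X₁ ∪ X₃))
    (ho₃ : X₃ \ (X₁ ∪ X₂) ⊆ outerPart (X₁ ∪ X₂)) : False := by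
  obtain ⟨p, hp⟩ := innerPart_union_nonempty hX₁ hX₂ hac h₁₂ hj₁ hj₂
  have hp₃ : p ∉ X₃ := fun h => disjoint_innerPart_outerPart hp (ho₃ ⟨h, hp.1⟩)
  have hp₁ : p ∉ X₁ := fun h => hp.1 (Or.inl h)
  have hp₂ : p ∉ X₂ := fun h => hp.1 (Or.inr h)
  have e₁ : (X₁ ∪ X₂) ∩ (X₁ ∪ X₃) = X₁ := by
    rw [← union_inter_distrib_left, h₂₃, ← h₁₂]; simp
  have e₂ : (X₁ ∪ X₂) ∩ (X₂ ∪ X₃) = X₂ := by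
    rw [union_comm X₁ X₂, ← union_inter_distrib_left, h₁₃, ← h₁₂]; simp
  -- If p were enclosed by `X₁ ∪ X₃` as well as by `X₁ ∪ X₂`, it would be enclosed by their
  -- intersection `X₁`, which admits a logarithm.
  have hl₁₃ : HasLogOn (fun z => z - p) (X₁ ∪ X₃) := by
    rcases mem_outerPart_or_mem_innerPart (K := X₁ ∪ X₃) (p := p) (by simp [hp₁, hp₃]) with h | h
    · exact hasLogOn_of_mem_outerPart (hX₁.union hX₃) h
    · have := mem_innerPart_inter (hX₁.union hX₂).isClosed (hX₁.union hX₃).isClosed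
        (fun z hz => ho₃ ⟨hz.1.resolve_left fun h => hz.2 (Or.inl h), hz.2⟩)
        (fun z hz => ho₂ ⟨hz.1.resolve_left fun h => hz.2 (Or.inl h), hz.2⟩) hp h
      rw [e₁] at this
      exact absurd (hl₁ p hp₁) (not_hasLogOn_of_mem_innerPart hX₁ this)
  have hl₂₃ : HasLogOn (fun z => z - p) (X₂ ∪ X₃) := by
    rcases mem_outerPart_or_mem_innerPart (K := X₂ ∪ X₃) (p := p) (by simp [hp₂, hp₃]) with h | h
    · exact hasLogOn_of_mem_outerPart (hX₂.union hX₃) h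
    · have := mem_innerPart_inter (hX₁.union hX₂).isClosed (hX₂.union hX₃).isClosed
        (fun z hz => ho₃ ⟨hz.1.resolve_left fun h => hz.2 (Or.inr h), hz.2⟩)
        (fun z hz => ho₁ ⟨hz.1.resolve_right fun h => hz.2 (Or.inl h), hz.2⟩) hp h
      rw [e₂] at this
      exact absurd (hl₂ p hp₂) (not_hasLogOn_of_mem_innerPart hX₂ this)
  have e₃ : (X₁ ∪ X₃) ∩ (X₂ ∪ X₃) = X₃ := by
    rw [← inter_union_distrib_right, h₁₂, ← h₁₃]; simp
  -- Gluing along the connected `X₃` yields a logarithm on a set that contains `X₁ ∪ X₂`.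
  have := hl₁₃.union_of_isClosed (hX₁.union hX₃).isClosed (hX₂.union hX₃).isClosed
    (by rwa [e₃]) hl₂₃
  refine not_hasLogOn_of_mem_innerPart (hX₁.union hX₂) hp (this.mono ?_)
  rintro z (hz | hz)
  · exact Or.inl (Or.inl hz)
  · exact Or.inr (Or.inl hz)

/-! ### Drawings in the complex plane -/

variable {V : Type*} {G : SimpleGraph V}

/-- A crossing-free drawing in the complex plane with every vertex on the outer face. -/
structure OuterDrawing (G : SimpleGraph V) where
  /-- the point that represents a vertex -/
  pos : V → ℂ
  pos_injective : Function.Injective pos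
  /-- the point set that represents an edge -/
  arc : Sym2 V → Set ℂ
  isArc : ∀ u v : V, G.Adj u v →
    ∃ γ : Path (pos u) (pos v), Function.Injective γ ∧ Set.range γ = arc s(u, v)
  vertex_of_mem_arc : ∀ e ∈ G.edgeSet, ∀ v : V, pos v ∈ arc e → v ∈ e
  common_end : ∀ e ∈ G.edgeSet, ∀ f ∈ G.edgeSet, e ≠ f →
    ∀ p ∈ arc e ∩ arc f, ∃ v : V, v ∈ e ∧ v ∈ f ∧ pos v = p
  mem_closure_outer : ∀ v : V, pos v ∈ closure (outerPart (range pos ∪ ⋃ e ∈ G.edgeSet, arc e))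

theorem IsOuterplanar.nonempty_outerDrawing (h : IsOuterplanar G) : Nonempty (OuterDrawing G) := by
  obtain ⟨D, hD⟩ := h
  let Φ : Plane ≃ₗᵢ[ℝ] ℂ := Complex.orthonormalBasisOneI.repr.symm
  let Ψ : Plane ≃ₜ ℂ := Φ.toHomeomorph
  have hΨ : ∀ x, Ψ x = Φ x := fun _ => rfl
  have himg : Ψ '' D.image =
      range (fun v => Ψ (D.pos v)) ∪ ⋃ e ∈ G.edgeSet, Ψ '' D.arc e := by
    rw [PlaneDrawing.image, image_union, ← range_comp, image_iUnion₂]; rfl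
  have hout : Ψ '' D.outerFace ⊆ outerPart (Ψ '' D.image) := by
    rintro _ ⟨p, hp, rfl⟩
    refine ⟨fun ⟨q, hq, hqp⟩ => hp.1 (Ψ.injective hqp ▸ hq), fun hb => hp.2 ?_⟩
    rw [← image_compl_eq Ψ.bijective, ← Ψ.image_connectedComponentIn hp.1] at hb
    have := (Φ.symm.lipschitz.isBounded_image hb)
    refine this.subset fun x hx => ⟨Ψ x, mem_image_of_mem _ hx, ?_⟩
    exact Φ.symm_apply_apply x
  refine ⟨⟨fun v => Ψ (D.pos v), Ψ.injective.comp D.pos_injective, fun e => Ψ '' D.arc e,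
    ?_, ?_, ?_, ?_⟩⟩
  · intro u v huv
    obtain ⟨γ, hγ, hr⟩ := D.isArc u v huv
    refine ⟨γ.map Ψ.continuous, Ψ.injective.comp hγ, ?_⟩
    rw [← hr, ← range_comp]; rfl
  · rintro e he v ⟨q, hq, hqv⟩
    exact D.vertex_of_mem_arc e he v (Ψ.injective hqv ▸ hq)
  · rintro e he f hf hef _ ⟨⟨p, hp, rfl⟩, q, hq, hqp⟩
    obtain ⟨v, h1, h2, h3⟩ := D.common_end e he f hf hef p ⟨hp, Ψ.injective hqp ▸ hq⟩
    exact ⟨v, h1, h2, by rw [h3]⟩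
  · intro v
    have h1 := mem_image_of_mem Ψ (frontier_subset_closure (hD v))
    rw [Ψ.image_closure] at h1
    have h2 := closure_mono hout h1
    rwa [himg] at h2

namespace OuterDrawing

variable (D : OuterDrawing G)

/-- The set of points covered by the drawing of a subgraph. -/
def carrier (H : G.Subgraph) : Set ℂ := D.pos '' H.verts ∪ ⋃ e ∈ H.edgeSet, D.arc e

theorem mem_carrier {H : G.Subgraph} {p : ℂ} :
    p ∈ D.carrier H ↔ (∃ v ∈ H.verts, D.pos v = p) ∨ ∃ e ∈ H.edgeSet, p ∈ D.arc e := by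
  simp [carrier]

theorem pos_mem_arc {v : V} {e : Sym2 V} (he : e ∈ G.edgeSet) (hv : v ∈ e) :
    D.pos v ∈ D.arc e := by
  obtain ⟨u, rfl⟩ := hv
  obtain ⟨γ, -, hr⟩ := D.isArc v u he
  rw [← hr]
  exact ⟨0, γ.source⟩

theorem isCompact_arc {e : Sym2 V} (he : e ∈ G.edgeSet) : IsCompact (D.arc e) := by
  induction e with | _ u v
  obtain ⟨γ, -, hr⟩ := D.isArc u v he
  rw [← hr]
  exact isCompact_range γ.continuous

theorem isCompact_carrier [Finite V] (H : G.Subgraph) : IsCompact (D.carrier H) :=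
  ((toFinite _).image _).isCompact.union
    ((toFinite _).isCompact_biUnion fun _ he => D.isCompact_arc (H.edgeSet_subset he))

theorem pos_mem_carrier {H : G.Subgraph} {v : V} : D.pos v ∈ D.carrier H ↔ v ∈ H.verts := by
  rw [mem_carrier]
  constructor
  · rintro (⟨w, hw, h⟩ | ⟨e, he, h⟩)
    · exact D.pos_injective h ▸ hw
    · exact H.mem_verts_of_mem_edge he (D.vertex_of_mem_arc e (H.edgeSet_subset he) v h)
  · exact fun h => Or.inl ⟨v, h, rfl⟩

theorem carrier_sup (H H' : G.Subgraph) : D.carrier (H ⊔ H') = D.carrier H ∪ D.carrier H' := by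
  ext p
  simp only [mem_carrier, mem_union, SimpleGraph.Subgraph.verts_sup,
    SimpleGraph.Subgraph.edgeSet_sup, or_and_right, exists_or]
  exact or_or_or_comm

/-- This is where the absence of crossings is used: distinct edges share only common ends, so the
drawing turns meets of subgraphs into intersections. -/
theorem carrier_inf (H H' : G.Subgraph) : D.carrier (H ⊓ H') = D.carrier H ∩ D.carrier H' := by
  ext p
  constructor
  · rw [mem_inter_iff, mem_carrier, mem_carrier, mem_carrier]
    rintro (⟨v, hv, rfl⟩ | ⟨e, he, hp⟩)
    · exact ⟨Or.inl ⟨v, hv.1, rfl⟩, Or.inl ⟨v, hv.2, rfl⟩⟩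
    · rw [SimpleGraph.Subgraph.edgeSet_inf] at he
      exact ⟨Or.inr ⟨e, he.1, hp⟩, Or.inr ⟨e, he.2, hp⟩⟩
  · rintro ⟨h, h'⟩
    rw [mem_carrier] at h
    rcases h with ⟨v, hv, rfl⟩ | ⟨e, he, hp⟩
    · exact D.pos_mem_carrier.2 ⟨hv, D.pos_mem_carrier.1 h'⟩
    · rw [mem_carrier] at h'
      rcases h' with ⟨v, hv, rfl⟩ | ⟨f, hf, hp'⟩
      · exact D.pos_mem_carrier.2
          ⟨D.pos_mem_carrier.1 (D.mem_carrier.2 (Or.inr ⟨e, he, hp⟩)), hv⟩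
      · by_cases hef : e = f
        · subst hef
          refine D.mem_carrier.2 (Or.inr ⟨e, ?_, hp⟩)
          rw [SimpleGraph.Subgraph.edgeSet_inf]
          exact ⟨he, hf⟩
        · obtain ⟨v, hv, hv', rfl⟩ := D.common_end e (H.edgeSet_subset he) f
            (H'.edgeSet_subset hf) hef p ⟨hp, hp'⟩
          exact D.pos_mem_carrier.2 ⟨H.mem_verts_of_mem_edge he hv,
            H'.mem_verts_of_mem_edge hf hv'⟩

theorem carrier_subgraphOfAdj {u v : V} (h : G.Adj u v) :
    D.carrier (G.subgraphOfAdj h) = D.arc s(u, v) := by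
  ext p
  simp only [mem_carrier, SimpleGraph.subgraphOfAdj_verts, SimpleGraph.edgeSet_subgraphOfAdj,
    mem_singleton_iff, exists_eq_left]
  refine ⟨?_, Or.inr⟩
  rintro (⟨w, hw, rfl⟩ | hp)
  · refine D.pos_mem_arc h ?_
    rcases hw with rfl | rfl <;> simp
  · exact hp

theorem carrier_singletonSubgraph (v : V) : D.carrier (G.singletonSubgraph v) = {D.pos v} := by
  ext p
  simp [mem_carrier, eq_comm]

/-- The vertex is a limit of outer points of the whole drawing, and erasing parts of the drawing
only enlarges the outer part. -/
theorem pos_mem_outerPart [Finite V] {H : G.Subgraph} {v : V} (hv : v ∉ H.verts) :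
    D.pos v ∈ outerPart (D.carrier H) := by
  refine mem_outerPart_of_mem_closure (D.isCompact_carrier H).isClosed
    (fun h => hv (D.pos_mem_carrier.1 h)) ?_
  refine closure_mono (outerPart_anti ?_) (D.mem_closure_outer v)
  refine union_subset_union (image_subset_range _ _) ?_
  exact biUnion_subset_biUnion_left H.edgeSet_subset

theorem isPreconnected_arc_diff {u v : V} (h : G.Adj u v) :
    IsPreconnected (D.arc s(u, v) \ {D.pos v}) := by
  obtain ⟨γ, hγ, hr⟩ := D.isArc u v h
  have : D.arc s(u, v) \ {D.pos v} = γ '' Iio 1 := by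
    rw [← hr]
    ext p
    constructor
    · rintro ⟨⟨t, rfl⟩, ht⟩
      refine ⟨t, lt_of_le_of_ne unitInterval.le_one' ?_, rfl⟩
      rintro rfl
      exact ht γ.target
    · rintro ⟨t, ht, rfl⟩
      refine ⟨⟨t, rfl⟩, fun h => ?_⟩
      exact ne_of_lt ht (hγ (h.trans γ.target.symm))
  rw [this]
  exact isPreconnected_Iio.image _ γ.continuous.continuousOn

/-- An arc without its far end t is connected. If its end w is not in H', this piece avoids the
drawing of H' and contains the outer point w. -/
theorem carrier_diff_subset_outerPart [Finite V] {H H' : G.Subgraph}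
    (h : ∀ e ∈ H.edgeSet, e ∈ H'.edgeSet ∨ ∃ w ∈ e, w ∉ H'.verts) :
    D.carrier H \ D.carrier H' ⊆ outerPart (D.carrier H') := by
  rintro p ⟨hp, hp'⟩
  rw [mem_carrier] at hp
  rcases hp with ⟨v, hv, rfl⟩ | ⟨e, he, hpe⟩
  · exact D.pos_mem_outerPart fun h => hp' (D.pos_mem_carrier.2 h)
  · rcases h e he with he' | ⟨w, hw, hw'⟩
    · exact absurd (D.mem_carrier.2 (Or.inr ⟨e, he', hpe⟩)) hp'
    · obtain ⟨t, rfl⟩ := hw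
      have hwt : G.Adj w t := H.edgeSet_subset he
      by_cases hpt : p = D.pos t
      · subst hpt
        exact D.pos_mem_outerPart fun h => hp' (D.pos_mem_carrier.2 h)
      refine mem_outerPart_of_isPreconnected (D.isPreconnected_arc_diff hwt) ?_
        (p := D.pos w) ⟨D.pos_mem_arc hwt (by simp), fun h => hwt.ne (D.pos_injective h)⟩
        ⟨hpe, hpt⟩ (D.pos_mem_outerPart hw')
      rw [disjoint_left]
      rintro q ⟨hq, hqt⟩ hqH
      have : q ∈ D.carrier (G.subgraphOfAdj hwt ⊓ H') := by
        rw [carrier_inf, carrier_subgraphOfAdj]; exact ⟨hq, hqH⟩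
      rw [mem_carrier] at this
      rcases this with ⟨v, ⟨hv, hv'⟩, rfl⟩ | ⟨f, hf, -⟩
      · rcases hv with rfl | rfl
        · exact hw' hv'
        · exact hqt rfl
      · rw [SimpleGraph.Subgraph.edgeSet_inf, SimpleGraph.edgeSet_subgraphOfAdj] at hf
        obtain rfl := hf.1
        exact hw' (H'.mem_verts_of_mem_edge hf.2 (by simp))

theorem joinedIn_arc {u v : V} (h : G.Adj u v) :
    JoinedIn (D.arc s(u, v)) (D.pos u) (D.pos v) := by
  obtain ⟨γ, hγ, hr⟩ := D.isArc u v h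
  exact ⟨γ, fun t => hr ▸ mem_range_self t⟩

theorem isPreconnected_arc {u v : V} (h : G.Adj u v) : IsPreconnected (D.arc s(u, v)) := by
  obtain ⟨γ, hγ, hr⟩ := D.isArc u v h
  rw [← hr]
  exact isPreconnected_range γ.continuous

theorem hasLogOn_arc {u v : V} (h : G.Adj u v) {p : ℂ} (hp : p ∉ D.arc s(u, v)) :
    HasLogOn (fun z => z - p) (D.arc s(u, v)) := by
  obtain ⟨γ, hγ, hr⟩ := D.isArc u v h
  rw [← hr] at hp ⊢
  exact hasLogOn_range_of_injective γ hγ (by fun_prop) fun z hz h =>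
    hp (by rwa [← sub_eq_zero.1 h])

theorem joinedIn_walk {u v : V} (P : G.Walk u v) :
    JoinedIn (D.carrier P.toSubgraph) (D.pos u) (D.pos v) := by
  induction P with
  | nil => exact JoinedIn.refl (D.pos_mem_carrier.2 (by simp))
  | cons h P ih =>
    rw [SimpleGraph.Walk.toSubgraph, carrier_sup, carrier_subgraphOfAdj]
    exact ((D.joinedIn_arc h).mono subset_union_left).trans (ih.mono subset_union_right)

theorem isPreconnected_walk {u v : V} (P : G.Walk u v) :
    IsPreconnected (D.carrier P.toSubgraph) := by
  induction P with
  | nil =>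
    rw [SimpleGraph.Walk.toSubgraph, carrier_singletonSubgraph]
    exact isPreconnected_singleton
  | cons h P ih =>
    rw [SimpleGraph.Walk.toSubgraph, carrier_sup, carrier_subgraphOfAdj]
    exact (D.isPreconnected_arc h).union _ (D.pos_mem_arc h (Sym2.mem_mk_right _ _))
      (D.pos_mem_carrier.2 (by simp)) ih

/-- By induction on the path: the first arc meets the remaining path only in one point, so the
logarithms glue. -/
theorem hasLogOn_path [Finite V] {u v : V} (P : G.Walk u v) (hP : P.IsPath) {p : ℂ}
    (hp : p ∉ D.carrier P.toSubgraph) :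
    HasLogOn (fun z => z - p) (D.carrier P.toSubgraph) := by
  induction P with
  | @nil u =>
    rw [SimpleGraph.Walk.toSubgraph, carrier_singletonSubgraph] at hp ⊢
    refine ⟨fun _ => Complex.log (D.pos u - p), continuousOn_const, fun z hz => ?_⟩
    rw [mem_singleton_iff.1 hz, Complex.exp_log (sub_ne_zero.2 fun h => hp h.symm)]
  | @cons u w v h P ih =>
    rw [SimpleGraph.Walk.cons_isPath_iff] at hP
    have hint : D.arc s(u, w) ∩ D.carrier P.toSubgraph = {D.pos w} := by
      rw [← D.carrier_subgraphOfAdj h, ← carrier_inf, ← carrier_singletonSubgraph]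
      congr 1
      have hu : u ∉ P.toSubgraph.verts := by simpa using hP.2
      ext a b
      · simp only [SimpleGraph.Subgraph.verts_inf, SimpleGraph.subgraphOfAdj_verts, mem_inter_iff,
          SimpleGraph.singletonSubgraph_verts, mem_singleton_iff, mem_insert_iff]
        constructor
        · rintro ⟨rfl | rfl, h'⟩
          · exact absurd h' hu
          · rfl
        · rintro rfl; exact ⟨Or.inr rfl, by simp⟩
      · simp only [SimpleGraph.Subgraph.inf_adj, SimpleGraph.subgraphOfAdj_adj,
          SimpleGraph.singletonSubgraph_adj, Pi.bot_apply, Prop.bot_eq_false, iff_false]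
        rintro ⟨he, hab⟩
        have : u = a ∨ u = b := by
          have : u ∈ s(a, b) := he ▸ Sym2.mem_mk_left _ _
          simpa using this
        rcases this with rfl | rfl
        · exact hu (P.toSubgraph.edge_vert hab)
        · exact hu (P.toSubgraph.edge_vert hab.symm)
    rw [SimpleGraph.Walk.toSubgraph, carrier_sup, carrier_subgraphOfAdj] at hp ⊢
    exact (D.hasLogOn_arc h fun h' => hp (Or.inl h')).union_of_isClosed
      (D.isCompact_arc h).isClosed (D.isCompact_carrier _).isClosed
      (by rw [hint]; exact isPreconnected_singleton) (ih hP.1 fun h' => hp (Or.inr h'))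

/-- Graph form of `theta_not_outer`. The edge conditions exclude the edge from a to c, so that two
of the drawn paths meet only in the two ends. -/
theorem false_of_theta (D : OuterDrawing G) [Finite V] {a c : V} (hac : a ≠ c)
    {Q₁ Q₂ Q₃ : G.Walk a c}
    (h₁ : Q₁.IsPath) (h₂ : Q₂.IsPath)
    (h₁₂ : ∀ w ∈ Q₁.support, w ∈ Q₂.support → w = a ∨ w = c)
    (h₁₃ : ∀ w ∈ Q₁.support, w ∈ Q₃.support → w = a ∨ w = c)
    (h₂₃ : ∀ w ∈ Q₂.support, w ∈ Q₃.support → w = a ∨ w = c)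
    (he₁ : ∀ e ∈ Q₁.edges, ∃ w ∈ e, w ≠ a ∧ w ≠ c)
    (he₂ : ∀ e ∈ Q₂.edges, ∃ w ∈ e, w ≠ a ∧ w ≠ c)
    (he₃ : ∀ e ∈ Q₃.edges, ∃ w ∈ e, w ≠ a ∧ w ≠ c) : False := by
  have hint : ∀ {P Q : G.Walk a c}, (∀ w ∈ P.support, w ∈ Q.support → w = a ∨ w = c) →
      (∀ e ∈ P.edges, ∃ w ∈ e, w ≠ a ∧ w ≠ c) →
      D.carrier P.toSubgraph ∩ D.carrier Q.toSubgraph = {D.pos a, D.pos c} := by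
    intro P Q hPQ hP
    rw [← carrier_inf]
    ext p
    rw [mem_carrier]
    constructor
    · rintro (⟨v, ⟨hv, hv'⟩, rfl⟩ | ⟨e, he, -⟩)
      · rcases hPQ v (by simpa using hv) (by simpa using hv') with rfl | rfl <;> simp
      · rw [SimpleGraph.Subgraph.edgeSet_inf] at he
        obtain ⟨w, hw, h1, h2⟩ := hP e (by simpa using he.1)
        have hwP := P.toSubgraph.mem_verts_of_mem_edge he.1 hw
        have hwQ := Q.toSubgraph.mem_verts_of_mem_edge he.2 hw
        rcases hPQ w (by simpa using hwP) (by simpa using hwQ) with h | h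
        · exact absurd h h1
        · exact absurd h h2
    · rintro (rfl | rfl)
      · exact Or.inl ⟨a, ⟨by simp, by simp⟩, rfl⟩
      · exact Or.inl ⟨c, ⟨by simp, by simp⟩, rfl⟩
  have hout : ∀ {P Q R : G.Walk a c}, (∀ w ∈ P.support, w ∈ Q.support → w = a ∨ w = c) →
      (∀ w ∈ P.support, w ∈ R.support → w = a ∨ w = c) →
      (∀ e ∈ P.edges, ∃ w ∈ e, w ≠ a ∧ w ≠ c) →
      D.carrier P.toSubgraph \ (D.carrier Q.toSubgraph ∪ D.carrier R.toSubgraph) ⊆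
        outerPart (D.carrier Q.toSubgraph ∪ D.carrier R.toSubgraph) := by
    intro P Q R hPQ hPR hP
    rw [← carrier_sup]
    refine D.carrier_diff_subset_outerPart fun e he => Or.inr ?_
    obtain ⟨w, hw, h1, h2⟩ := hP e (by simpa using he)
    have hwP := P.toSubgraph.mem_verts_of_mem_edge he hw
    refine ⟨w, hw, ?_⟩
    rintro (h | h)
    · rcases hPQ w (by simpa using hwP) (by simpa using h) with h | h
      · exact h1 h
      · exact h2 h
    · rcases hPR w (by simpa using hwP) (by simpa using h) with h | h
      · exact h1 h
      · exact h2 h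
  exact theta_not_outer (fun h => hac (D.pos_injective h)) (D.isCompact_carrier _)
    (D.isCompact_carrier _) (D.isCompact_carrier _) (D.joinedIn_walk Q₁) (D.joinedIn_walk Q₂)
    (D.isPreconnected_walk Q₃) (fun p => D.hasLogOn_path Q₁ h₁) (fun p => D.hasLogOn_path Q₂ h₂)
    (hint h₁₂ he₁) (hint h₁₃ he₁) (hint h₂₃ he₂)
    (hout h₁₂ h₁₃ he₁) (hout (fun w h h' => h₁₂ w h' h) h₂₃ he₂)
    (hout (fun w h h' => h₁₃ w h' h) (fun w h h' => h₂₃ w h' h) he₃)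

/-- The points covered by the drawing of an induced subgraph. -/
def inducedCarrier (s : Set V) : Set ℂ := D.carrier ((⊤ : G.Subgraph).induce s)

theorem inducedCarrier_inter (s t : Set V) :
    D.inducedCarrier s ∩ D.inducedCarrier t = D.inducedCarrier (s ∩ t) := by
  rw [inducedCarrier, inducedCarrier, ← carrier_inf, inducedCarrier]
  congr 1
  ext a b
  · simp
  · simp; tauto

theorem inducedCarrier_singleton (a : V) : D.inducedCarrier {a} = {D.pos a} := by
  rw [inducedCarrier, ← carrier_singletonSubgraph]
  congr 1
  ext x y
  · simp
  · simp only [SimpleGraph.Subgraph.induce_adj, mem_singleton_iff, SimpleGraph.Subgraph.top_adj,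
      SimpleGraph.singletonSubgraph_adj, Pi.bot_apply, Prop.bot_eq_false, iff_false]
    rintro ⟨rfl, rfl, h⟩
    exact h.ne rfl

theorem inducedCarrier_pair {a b : V} (h : G.Adj a b) :
    D.inducedCarrier {a, b} = D.arc s(a, b) := by
  rw [inducedCarrier, ← D.carrier_subgraphOfAdj h]
  congr 1
  ext x y
  · simp
  · simp only [SimpleGraph.Subgraph.induce_adj, mem_insert_iff, mem_singleton_iff,
      SimpleGraph.Subgraph.top_adj, SimpleGraph.subgraphOfAdj_adj, Sym2.eq_iff]
    constructor
    · rintro ⟨rfl | rfl, rfl | rfl, h'⟩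
      · exact absurd rfl h'.ne
      · simp
      · simp
      · exact absurd rfl h'.ne
    · rintro (⟨rfl, rfl⟩ | ⟨rfl, rfl⟩)
      · simp [h]
      · simp [h.symm]

theorem inducedCarrier_triple (a b c : V) : D.inducedCarrier {a, b, c} =
    D.inducedCarrier {a, b} ∪ (D.inducedCarrier {a, c} ∪ D.inducedCarrier {b, c}) := by
  simp only [inducedCarrier, ← carrier_sup]
  congr 1
  ext x y
  · simp; tauto
  · simp only [SimpleGraph.Subgraph.induce_adj, SimpleGraph.Subgraph.sup_adj, mem_insert_iff,
      mem_singleton_iff, SimpleGraph.Subgraph.top_adj]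
    constructor
    · rintro ⟨rfl | rfl | rfl, rfl | rfl | rfl, h⟩ <;> first | exact absurd rfl h.ne | simp [h]
    · tauto

theorem inducedCarrier_diff_subset [Finite V] (s t : Set V) :
    D.inducedCarrier s \ D.inducedCarrier t ⊆ outerPart (D.inducedCarrier t) := by
  refine D.carrier_diff_subset_outerPart fun e he => ?_
  induction e with | _ x y
  simp only [SimpleGraph.Subgraph.mem_edgeSet, SimpleGraph.Subgraph.induce_adj,
    SimpleGraph.Subgraph.top_adj, Sym2.mem_iff, SimpleGraph.Subgraph.induce_verts] at he ⊢
  by_cases hx : x ∈ t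
  · by_cases hy : y ∈ t
    · exact Or.inl ⟨hx, hy, he.2.2⟩
    · exact Or.inr ⟨y, Or.inr rfl, hy⟩
  · exact Or.inr ⟨x, Or.inl rfl, hx⟩

/-- A point p inside the triangle abc is enclosed by none of the other three triangles, since
otherwise it would be enclosed by a common edge. The logarithms on those triangles glue, first along
cd and then along the connected union of bd and ad, to one on a set containing abc. -/
theorem false_of_isClique_four (D : OuterDrawing G) [Finite V] {a b c d : V}
    (hab : G.Adj a b) (hac : G.Adj a c)
    (had : G.Adj a d) (hbc : G.Adj b c) (hbd : G.Adj b d) (hcd : G.Adj c d) : False := by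
  have hcomp : ∀ s, IsCompact (D.inducedCarrier s) := fun s => D.isCompact_carrier _
  have hI : ∀ {s t u : Set V}, s ∩ t = u →
      D.inducedCarrier s ∩ D.inducedCarrier t = D.inducedCarrier u := by
    rintro s t u rfl
    exact D.inducedCarrier_inter s t
  have nab := hab.ne
  have nac := hac.ne
  have nad := had.ne
  have nbc := hbc.ne
  have nbd := hbd.ne
  have ncd := hcd.ne
  obtain ⟨p, hp⟩ : (innerPart (D.inducedCarrier {a, b, c})).Nonempty := by
    rw [inducedCarrier_triple]
    refine innerPart_union_nonempty (hcomp _) ((hcomp _).union (hcomp _))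
      (fun h => nab (D.pos_injective h)) ?_ ?_ ?_
    · rw [inter_union_distrib_left, hI (u := {a}) (by ext x; simp; grind),
        hI (u := {b}) (by ext x; simp; grind), inducedCarrier_singleton, inducedCarrier_singleton]
      rfl
    · rw [D.inducedCarrier_pair hab]; exact D.joinedIn_arc hab
    · rw [D.inducedCarrier_pair hac, D.inducedCarrier_pair hbc]
      exact ((D.joinedIn_arc hac).mono subset_union_left).trans
        ((D.joinedIn_arc hbc).symm.mono subset_union_right)
  have hlog : ∀ {x y : V} {t : Set V}, G.Adj x y → {a, b, c} ∩ t = {x, y} →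
      HasLogOn (fun z => z - p) (D.inducedCarrier t) := by
    intro x y t hxy ht
    have hpt : p ∉ D.inducedCarrier t := fun h =>
      disjoint_innerPart_outerPart hp (D.inducedCarrier_diff_subset t _ ⟨h, hp.1⟩)
    rcases mem_outerPart_or_mem_innerPart hpt with h | h
    · exact hasLogOn_of_mem_outerPart (hcomp t) h
    · have h1 := mem_innerPart_inter (hcomp _).isClosed (hcomp _).isClosed
        (D.inducedCarrier_diff_subset _ _) (D.inducedCarrier_diff_subset _ _) hp h
      rw [hI ht, D.inducedCarrier_pair hxy] at h1
      exact absurd (D.hasLogOn_arc hxy h1.1)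
        (not_hasLogOn_of_mem_innerPart (D.isCompact_arc hxy) h1)
  have l₁ := hlog (t := {b, c, d}) hbc (by ext x; simp; grind)
  have l₂ := hlog (t := {a, c, d}) hac (by ext x; simp; grind)
  have l₃ := hlog (t := {a, b, d}) hab (by ext x; simp; grind)
  have l₁₂ := l₁.union_of_isClosed (hcomp _).isClosed (hcomp _).isClosed
    (by rw [hI (u := {c, d}) (by ext x; simp; grind), D.inducedCarrier_pair hcd]
        exact D.isPreconnected_arc hcd) l₂
  have l := l₁₂.union_of_isClosed ((hcomp _).union (hcomp _)).isClosed (hcomp _).isClosed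
    (by rw [union_inter_distrib_right, hI (u := {b, d}) (by ext x; simp; grind),
          hI (u := {a, d}) (by ext x; simp; grind), D.inducedCarrier_pair hbd,
          D.inducedCarrier_pair had]
        exact (D.isPreconnected_arc hbd).union _ (D.pos_mem_arc hbd (Sym2.mem_mk_right _ _))
          (D.pos_mem_arc had (Sym2.mem_mk_right _ _)) (D.isPreconnected_arc had)) l₃
  refine not_hasLogOn_of_mem_innerPart (hcomp _) hp (l.mono ?_)
  rw [inducedCarrier_triple, inducedCarrier_triple, inducedCarrier_triple, inducedCarrier_triple]
  intro z
  simp only [mem_union]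
  tauto

end OuterDrawing

end OuterplanarSpread

/-! ### Combinatorial consequences: common neighbours, number of edges, links. -/

namespace OuterplanarSpread

open Set

variable {V : Type*} {G : SimpleGraph V}

theorem exists_isPath_of_preconnected_induce {A : Set V} (hA : (G.induce A).Preconnected)
    {a b : V} (ha : a ∈ A) (hb : b ∈ A) :
    ∃ P : G.Walk a b, P.IsPath ∧ ∀ w ∈ P.support, w ∈ A := by
  classical
  obtain ⟨W⟩ := hA ⟨a, ha⟩ ⟨b, hb⟩
  let W' : G.Walk a b := W.map (SimpleGraph.Embedding.induce A).toHom
  refine ⟨W'.bypass, W'.bypass_isPath, fun w hw => ?_⟩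
  have : w ∈ (W.map (SimpleGraph.Embedding.induce A).toHom).support :=
    W'.support_bypass_subset_support hw
  rw [SimpleGraph.Walk.support_map, List.mem_map] at this
  obtain ⟨x, -, rfl⟩ := this
  exact x.2

theorem exists_walk_first_hit {S : Set V} {u v : V} (W : G.Walk u v) (hv : v ∈ S) :
    ∃ t ∈ S, ∃ W' : G.Walk u t, (∀ w ∈ W'.support, w ∈ W.support) ∧
      ∀ w ∈ W'.support, w ∈ S → w = t := by
  classical
  induction W with
  | nil => exact ⟨_, hv, .nil, by simp, by simp⟩
  | @cons u w v h W ih =>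
    by_cases hu : u ∈ S
    · exact ⟨u, hu, .nil, by simp, by simp⟩
    · obtain ⟨t, ht, W', h1, h2⟩ := ih hv
      refine ⟨t, ht, .cons h W', ?_, ?_⟩
      · intro x hx
        rw [SimpleGraph.Walk.support_cons, List.mem_cons] at hx ⊢
        exact hx.imp_right (h1 x)
      · intro x hx hxS
        rw [SimpleGraph.Walk.support_cons, List.mem_cons] at hx
        rcases hx with rfl | hx
        · exact absurd hxS hu
        · exact h2 x hx hxS

/-- A vertex `c` and a connected set with three common neighbours are impossible. -/
theorem OuterDrawing.false_of_three_common_neighbors (D : OuterDrawing G) [Finite V]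
    {c v₁ v₂ v₃ : V} (h₁₂ : v₁ ≠ v₂) (h₁₃ : v₁ ≠ v₃) (h₂₃ : v₂ ≠ v₃)
    (hc₁ : G.Adj c v₁) (hc₂ : G.Adj c v₂) (hc₃ : G.Adj c v₃) {A : Set V}
    (hA : (G.induce A).Preconnected) (hcA : c ∉ A) (hvA₁ : v₁ ∉ A) (hvA₂ : v₂ ∉ A) (hvA₃ : v₃ ∉ A)
    (ha₁ : ∃ a ∈ A, G.Adj v₁ a) (ha₂ : ∃ a ∈ A, G.Adj v₂ a) (ha₃ : ∃ a ∈ A, G.Adj v₃ a) :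
    False := by
  classical
  obtain ⟨a₁, ha₁, e₁⟩ := ha₁
  obtain ⟨a₂, ha₂, e₂⟩ := ha₂
  obtain ⟨a₃, ha₃, e₃⟩ := ha₃
  obtain ⟨P, hP, hPA⟩ := exists_isPath_of_preconnected_induce hA ha₁ ha₂
  obtain ⟨W, -, hWA⟩ := exists_isPath_of_preconnected_induce hA ha₃ ha₁
  -- `R` first meets `P` at t, so the two halves of `P` together with `R` form a tripod centred at
  -- t. Its legs, prolonged through v₁, v₂, v₃ to c, are the three connections of a theta.
  obtain ⟨t, ht, R, hRW, hRt⟩ := exists_walk_first_hit (S := {x | x ∈ P.support}) W (by simp)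
  have ht' : t ∈ P.support := ht
  have hPt : ∀ w ∈ (P.takeUntil t ht').support, w ∈ (P.dropUntil t ht').reverse.support →
      w = t := by
    intro w hw hw'
    have hnd := hP.support_nodup
    rw [← P.take_spec ht', SimpleGraph.Walk.support_append] at hnd
    rw [SimpleGraph.Walk.support_reverse, List.mem_reverse,
      ← SimpleGraph.Walk.cons_tail_support, List.mem_cons] at hw'
    exact hw'.resolve_right fun h => (List.nodup_append.1 hnd).2.2 w hw w h rfl
  have hR₁ : ∀ w ∈ (P.takeUntil t ht').support, w ∈ P.support := fun w hw =>
    P.support_takeUntil_subset_support ht' hw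
  have hR₂ : ∀ w ∈ (P.dropUntil t ht').reverse.support, w ∈ P.support := fun w hw =>
    P.support_dropUntil_subset_support ht' (by simpa using hw)
  have key : ∀ {v a : V} (hcv : G.Adj c v) (hva : G.Adj v a) (Q : G.Walk a t),
      (∀ w ∈ Q.support, w ∈ A) → ∀ e ∈ (SimpleGraph.Walk.cons hcv (.cons hva Q)).edges, v ∉ A →
        ∃ w ∈ e, w ≠ c ∧ w ≠ t := by
    intro v a hcv hva Q hQ e he hvA
    have htA : t ∈ A := hQ t (by simp)
    have hvt : v ≠ t := fun h => hvA (h ▸ htA)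
    rw [SimpleGraph.Walk.edges_cons, List.mem_cons, SimpleGraph.Walk.edges_cons,
      List.mem_cons] at he
    rcases he with rfl | rfl | he
    · exact ⟨v, by simp, hcv.ne', hvt⟩
    · exact ⟨v, by simp, hcv.ne', hvt⟩
    · induction e with | _ x y
      have hx := hQ x (Q.fst_mem_support_of_mem_edges he)
      have hy := hQ y (Q.snd_mem_support_of_mem_edges he)
      have hxy : G.Adj x y := Q.adj_of_mem_edges he
      by_cases hxt : x = t
      · exact ⟨y, by simp, fun h => hcA (h ▸ hy), fun h => hxy.ne (hxt.trans h.symm)⟩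
      · exact ⟨x, by simp, fun h => hcA (h ▸ hx), hxt⟩
  have hpath : ∀ {v a : V} (hcv : G.Adj c v) (hva : G.Adj v a) (Q : G.Walk a t),
      Q.IsPath → (∀ w ∈ Q.support, w ∈ A) → v ∉ A →
        (SimpleGraph.Walk.cons hcv (.cons hva Q)).IsPath := by
    intro v a hcv hva Q hQ hQA hv
    refine (hQ.cons fun h => hv (hQA _ h)).cons ?_
    rw [SimpleGraph.Walk.support_cons, List.mem_cons]
    rintro (h | h)
    · exact hcv.ne h
    · exact hcA (hQA _ h)
  have hsupp : ∀ {v v' a a' : V} (hcv : G.Adj c v) (hva : G.Adj v a) (hcv' : G.Adj c v')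
      (hva' : G.Adj v' a') (Q : G.Walk a t) (Q' : G.Walk a' t), v ≠ v' → v ∉ A → v' ∉ A →
      (∀ w ∈ Q.support, w ∈ A) → (∀ w ∈ Q'.support, w ∈ A) →
      (∀ w ∈ Q.support, w ∈ Q'.support → w = t) →
      ∀ w ∈ (SimpleGraph.Walk.cons hcv (.cons hva Q)).support,
        w ∈ (SimpleGraph.Walk.cons hcv' (.cons hva' Q')).support → w = c ∨ w = t := by
    intro v v' a a' hcv hva hcv' hva' Q Q' hvv hv hv' hQ hQ' hQQ w hw hw'
    simp only [SimpleGraph.Walk.support_cons, List.mem_cons] at hw hw'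
    rcases hw with rfl | rfl | hw
    · exact Or.inl rfl
    · rcases hw' with h | h | h
      · exact Or.inl h
      · exact absurd h hvv
      · exact absurd (hQ' _ h) hv
    · rcases hw' with h | rfl | h
      · exact Or.inl h
      · exact absurd (hQ _ hw) hv'
      · exact Or.inr (hQQ w hw h)
  have hRA : ∀ w ∈ R.support, w ∈ A := fun w hw => hWA w (hRW w hw)
  have hA₁ : ∀ w ∈ (P.takeUntil t ht').support, w ∈ A := fun w hw => hPA w (hR₁ w hw)
  have hA₂ : ∀ w ∈ (P.dropUntil t ht').reverse.support, w ∈ A := fun w hw => hPA w (hR₂ w hw)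
  refine D.false_of_theta (a := c) (c := t) (fun h => hcA (h ▸ hRA t (by simp)))
    (hpath hc₁ e₁ _ (hP.takeUntil ht') hA₁ hvA₁)
    (hpath hc₂ e₂ _ (hP.dropUntil ht').reverse hA₂ hvA₂)
    (hsupp hc₁ e₁ hc₂ e₂ _ _ h₁₂ hvA₁ hvA₂ hA₁ hA₂ hPt)
    (hsupp hc₁ e₁ hc₃ e₃ _ R h₁₃ hvA₁ hvA₃ hA₁ hRA fun w hw hw' => hRt w hw' (hR₁ w hw))
    (hsupp hc₂ e₂ hc₃ e₃ _ R h₂₃ hvA₂ hvA₃ hA₂ hRA fun w hw hw' => hRt w hw' (hR₂ w hw))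
    (fun e he => key hc₁ e₁ _ hA₁ e he hvA₁) (fun e he => key hc₂ e₂ _ hA₂ e he hvA₂)
    (fun e he => key hc₃ e₃ _ hRA e he hvA₃)

open Classical in
theorem OuterDrawing.card_common_neighbors_le_two (D : OuterDrawing G) [Fintype V] {u v : V}
    (huv : u ≠ v) : (Finset.univ.filter fun w => G.Adj u w ∧ G.Adj v w).card ≤ 2 := by
  by_contra! h
  obtain ⟨x, y, z, hx, hy, hz, hxy, hxz, hyz⟩ := Finset.two_lt_card_iff.1 h
  simp only [Finset.mem_filter, Finset.mem_univ, true_and] at hx hy hz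
  exact D.false_of_three_common_neighbors (A := {u}) hxy hxz hyz hx.2 hy.2 hz.2
    (SimpleGraph.Preconnected.of_subsingleton) (by simpa using huv.symm) (by simpa using hx.1.ne')
    (by simpa using hy.1.ne') (by simpa using hz.1.ne') ⟨u, rfl, hx.1.symm⟩ ⟨u, rfl, hy.1.symm⟩
    ⟨u, rfl, hz.1.symm⟩

/-- A chosen vertex of the connected component of `v`. -/
noncomputable def componentRoot (G : SimpleGraph V) (v : V) : V :=
  Quot.out (G.connectedComponentMk v)

theorem reachable_componentRoot (G : SimpleGraph V) (v : V) : G.Reachable (componentRoot G v) v :=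
  SimpleGraph.ConnectedComponent.exact (Quot.out_eq (G.connectedComponentMk v))

theorem componentRoot_eq_of_reachable {u v : V} (h : G.Reachable u v) :
    componentRoot G u = componentRoot G v := by
  rw [componentRoot, componentRoot, SimpleGraph.ConnectedComponent.sound h]

/-- The distance from the chosen vertex of the component. -/
noncomputable def level (G : SimpleGraph V) (v : V) : ℕ := G.dist (componentRoot G v) v

theorem level_le_of_adj {u v : V} (h : G.Adj u v) : level G v ≤ level G u + 1 := by
  obtain ⟨W, hW⟩ := (reachable_componentRoot G u).exists_walk_length_eq_dist
  rw [level, ← componentRoot_eq_of_reachable h.reachable, level, ← hW]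
  simpa using SimpleGraph.dist_le (W.concat h)

theorem exists_adj_level_lt {v : V} (h : 0 < level G v) :
    ∃ u, G.Adj v u ∧ level G u < level G v := by
  obtain ⟨W, hW⟩ := (reachable_componentRoot G v).symm.exists_walk_length_eq_dist
  have hne : v ≠ componentRoot G v := fun h' => by
    rw [level, ← h'] at h
    simp at h
  obtain ⟨u, hvu, W, rfl⟩ := W.exists_eq_cons_of_ne hne
  refine ⟨u, hvu, ?_⟩
  have h1 := SimpleGraph.dist_le W
  rw [SimpleGraph.Walk.length_cons, SimpleGraph.dist_comm] at hW
  rw [level, level, componentRoot_eq_of_reachable hvu.symm.reachable, ← hW,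
    SimpleGraph.dist_comm]
  omega

/-- Descending level by level stays below level i, so the lower levels of a component form a
connected set that can play the role of a single vertex. -/
theorem reachable_lower_levels (r : V) (i : ℕ) : ∀ k : ℕ, ∀ v : V, level G v = k →
    ∀ hv : v ∈ {u : V | componentRoot G u = r ∧ level G u < i},
      ∃ hr : r ∈ {u : V | componentRoot G u = r ∧ level G u < i},
        (G.induce {u : V | componentRoot G u = r ∧ level G u < i}).Reachable ⟨v, hv⟩ ⟨r, hr⟩ := by
  intro k
  induction k using Nat.strong_induction_on with
  | _ k ih =>
    intro v hk hv
    rcases Nat.eq_zero_or_pos k with rfl | hpos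
    · have : v = r := by
        rw [level, (reachable_componentRoot G v).dist_eq_zero_iff] at hk
        rw [← hk]; exact hv.1
      subst this
      exact ⟨hv, .rfl⟩
    · obtain ⟨u, hu, hlt⟩ := exists_adj_level_lt (hk ▸ hpos)
      have hu' : u ∈ {u : V | componentRoot G u = r ∧ level G u < i} :=
        ⟨(componentRoot_eq_of_reachable hu.symm.reachable).trans hv.1, hlt.trans hv.2⟩
      obtain ⟨hr, h⟩ := ih (level G u) (hk ▸ hlt) u rfl hu'
      refine ⟨hr, SimpleGraph.Reachable.trans (SimpleGraph.Adj.reachable ?_) h⟩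
      exact hu

-- Three neighbours of c on a positive level i all attach to the connected set of lower levels,
-- which omits c; this is a contracted K_{2,3}. Level 0 of a component contains only its root.
open Classical in
theorem OuterDrawing.card_neighbors_level_le_two (D : OuterDrawing G) [Fintype V] {c : V} {i : ℕ}
    (hi : i ≤ level G c) : (Finset.univ.filter fun w => G.Adj c w ∧ level G w = i).card ≤ 2 := by
  by_contra! h
  obtain ⟨x, y, z, hx, hy, hz, hxy, hxz, hyz⟩ := Finset.two_lt_card_iff.1 h
  simp only [Finset.mem_filter, Finset.mem_univ, true_and] at hx hy hz
  have hroot : ∀ {w}, G.Adj c w → componentRoot G w = componentRoot G c := fun h =>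
    componentRoot_eq_of_reachable h.symm.reachable
  rcases Nat.eq_zero_or_pos i with rfl | hpos
  · have h1 := hx.2
    have h2 := hy.2
    rw [level, (reachable_componentRoot G _).dist_eq_zero_iff] at h1 h2
    exact hxy (by rw [← h1, ← h2, hroot hx.1, hroot hy.1])
  · have hex : ∀ {w}, G.Adj c w → level G w = i →
        ∃ a ∈ {u : V | componentRoot G u = componentRoot G c ∧ level G u < i}, G.Adj w a := by
      intro w hw hwi
      obtain ⟨u, hu, hlt⟩ := exists_adj_level_lt (hwi ▸ hpos : 0 < level G w)
      exact ⟨u, ⟨(componentRoot_eq_of_reachable hu.symm.reachable).trans (hroot hw), hwi ▸ hlt⟩, hu⟩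
    refine D.false_of_three_common_neighbors hxy hxz hyz hx.1 hy.1 hz.1 ?_
      (fun h => absurd h.2 (by omega)) (fun h => absurd h.2 (by omega))
      (fun h => absurd h.2 (by omega)) (fun h => absurd h.2 (by omega))
      (hex hx.1 hx.2) (hex hy.1 hy.2) (hex hz.1 hz.2)
    rintro ⟨a, ha⟩ ⟨b, hb⟩
    obtain ⟨hr, h1⟩ := reachable_lower_levels (G := G) _ i _ a rfl ha
    obtain ⟨hr', h2⟩ := reachable_lower_levels (G := G) _ i _ b rfl hb
    exact h1.trans h2.symm

-- Every vertex has at most two neighbours one level down and at most two on its own level. Upward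
-- pairs are downward pairs read backwards, so the degree sum is at most (2 + 2 + 2)n.
open Classical in
theorem OuterDrawing.sum_card_neighbors_le (D : OuterDrawing G) [Fintype V] :
    ∑ v, (Finset.univ.filter fun w => G.Adj v w).card ≤ 6 * Fintype.card V := by
  have hlow : ∀ v, (Finset.univ.filter fun w => G.Adj v w ∧ level G w < level G v).card ≤ 2 := by
    intro v
    refine (Finset.card_le_card ?_).trans
      -- Truncated subtraction is harmless: at level 0 there are no lower neighbours to count.
      (D.card_neighbors_level_le_two (c := v) (i := level G v - 1) (by omega))
    intro w
    simp only [Finset.mem_filter, Finset.mem_univ, true_and]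
    rintro ⟨h, hlt⟩
    have := level_le_of_adj h.symm
    exact ⟨h, by omega⟩
  have hup : ∑ v, (Finset.univ.filter fun w => G.Adj v w ∧ level G v < level G w).card =
      ∑ v, (Finset.univ.filter fun w => G.Adj v w ∧ level G w < level G v).card := by
    simp only [Finset.card_filter]
    rw [Finset.sum_comm]
    simp only [G.adj_comm]
  have hsplit : ∀ v, (Finset.univ.filter fun w => G.Adj v w).card ≤
      (Finset.univ.filter fun w => G.Adj v w ∧ level G v < level G w).card +
      ((Finset.univ.filter fun w => G.Adj v w ∧ level G w = level G v).card +
      (Finset.univ.filter fun w => G.Adj v w ∧ level G w < level G v).card) := by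
    intro v
    refine le_trans (Finset.card_le_card ?_)
      ((Finset.card_union_le _ _).trans (Nat.add_le_add_left (Finset.card_union_le _ _) _))
    intro w
    simp only [Finset.mem_filter, Finset.mem_univ, true_and, Finset.mem_union]
    intro h
    rcases lt_trichotomy (level G v) (level G w) with h' | h' | h'
    · exact Or.inl ⟨h, h'⟩
    · exact Or.inr (Or.inl ⟨h, h'.symm⟩)
    · exact Or.inr (Or.inr ⟨h, h'⟩)
  refine (Finset.sum_le_sum fun v _ => hsplit v).trans ?_
  rw [Finset.sum_add_distrib, Finset.sum_add_distrib, hup]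
  have b1 : ∑ v, (Finset.univ.filter fun w => G.Adj v w ∧ level G w < level G v).card ≤
      ∑ _v : V, 2 := Finset.sum_le_sum fun v _ => hlow v
  have b2 : ∑ v, (Finset.univ.filter fun w => G.Adj v w ∧ level G w = level G v).card ≤
      ∑ _v : V, 2 := Finset.sum_le_sum fun v _ => D.card_neighbors_level_le_two le_rfl
  simp only [Finset.sum_const, Finset.card_univ, smul_eq_mul] at b1 b2
  omega

/-- A cycle of F together with x is a wheel. A triangle gives K₄. On a longer cycle, v has the
neighbours w, v₂ and x, and each of them is adjacent to the part of the cycle that remains after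
removing v, w and v₂. -/
theorem OuterDrawing.isAcyclic_of_adj_common (D : OuterDrawing G) [Finite V] {x : V}
    {F : SimpleGraph V} (hFG : F ≤ G) (hF : ∀ u v, F.Adj u v → G.Adj x u) : F.IsAcyclic := by
  classical
  rw [SimpleGraph.isAcyclic_iff_forall_adj_isBridge]
  intro v w hvw
  rw [SimpleGraph.isBridge_iff]
  intro hreach
  obtain ⟨P, hP⟩ := hreach.exists_isPath
  have hle : F.deleteEdges {s(v, w)} ≤ F := SimpleGraph.deleteEdges_le _
  obtain ⟨v₂, h₁, P, rfl⟩ := P.exists_eq_cons_of_ne hvw.ne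
  rw [SimpleGraph.Walk.cons_isPath_iff] at hP
  have hv₂w : v₂ ≠ w := by
    rintro rfl
    simp at h₁
  obtain ⟨u, h₂, P, rfl⟩ := P.exists_eq_cons_of_ne hv₂w
  rw [SimpleGraph.Walk.cons_isPath_iff] at hP
  obtain ⟨⟨hP, hv₂P⟩, hvP⟩ := hP
  have hxv := hF v w hvw
  have hxw := hF w v hvw.symm
  have hxv₂ := hF v₂ v (hle h₁).symm
  by_cases huw : u = w
  · subst huw
    exact D.false_of_isClique_four hxv hxv₂ hxw (hFG (hle h₁)) (hFG hvw) (hFG (hle h₂))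
  have hP' := hP.reverse
  obtain ⟨w₂, h₃, Q, hQ⟩ := P.reverse.exists_eq_cons_of_ne (Ne.symm huw)
  rw [hQ, SimpleGraph.Walk.cons_isPath_iff] at hP'
  have hQP : ∀ y ∈ Q.support, y ∈ P.support := by
    intro y hy
    have : y ∈ P.reverse.support := by rw [hQ]; simp [hy]
    simpa using this
  have hxQ : ∀ y ∈ Q.support, G.Adj x y := by
    intro y hy
    -- For a 4-cycle `Q` is a single vertex without edges, so its adjacency to x is read off from a
    -- neighbouring edge.
    by_cases hyw : w₂ = u
    · subst hyw
      have := (SimpleGraph.Walk.isPath_iff_nil.1 hP'.1).eq_nil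
      subst this
      simp only [SimpleGraph.Walk.support_nil, List.mem_singleton] at hy
      subst hy
      exact hF _ _ (hle h₃).symm
    · obtain ⟨e, he, hye⟩ := SimpleGraph.Walk.mem_support_iff_exists_mem_edges_of_not_nil
        (SimpleGraph.Walk.not_nil_of_ne hyw) |>.1 hy
      have he' : e ∈ F.edgeSet := (SimpleGraph.edgeSet_mono hle) (Q.edges_subset_edgeSet he)
      obtain ⟨y', rfl⟩ := hye
      exact hF _ _ he'
  have hconn := ((Q.mapLe (hle.trans hFG)).connected_induce_support).preconnected
  rw [SimpleGraph.Walk.support_mapLe_eq_support] at hconn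
  refine D.false_of_three_common_neighbors (c := v) (v₁ := w) (v₂ := v₂) (v₃ := x)
    (A := {y | y ∈ Q.support}) hv₂w.symm hxw.ne' hxv₂.ne' (hFG hvw) (hFG (hle h₁)) hxv.symm hconn
    ?_ hP'.2 (fun h => hv₂P (hQP _ h)) (fun h => (hxQ x h).ne rfl)
    ⟨w₂, by simp, hFG (hle h₃)⟩ ⟨u, by simp, hFG (hle h₂)⟩ ⟨w₂, by simp, hxQ _ (by simp)⟩
  intro h
  refine hvP ?_
  rw [SimpleGraph.Walk.support_cons]
  exact List.mem_cons_of_mem _ (hQP _ h)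

end OuterplanarSpread

/-! ### Straight-line drawings of fans. -/

namespace OuterplanarSpread

open Set Bornology

variable {V : Type*}

open Classical in
/-- The position of a vertex in the fan drawing: the hub `x` is the origin, the other vertices
lie on the line of height one. -/
noncomputable def fanPos (x : V) (r : V → ℤ) (v : V) : Plane :=
  if v = x then 0 else !₂[(r v : ℝ), 1]

/-- The straight segment that represents an edge. -/
noncomputable def fanArc (x : V) (r : V → ℤ) : Sym2 V → Set Plane :=
  Sym2.lift ⟨fun u v => segment ℝ (fanPos x r u) (fanPos x r v), fun _ _ => segment_symm ℝ _ _⟩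

theorem fanPos_hub (x : V) (r : V → ℤ) : fanPos x r x = 0 := if_pos rfl

theorem fanPos_zero {x v : V} (r : V → ℤ) (h : v ≠ x) : fanPos x r v 0 = r v := by
  simp [fanPos, h]

theorem fanPos_one {x v : V} (r : V → ℤ) (h : v ≠ x) : fanPos x r v 1 = 1 := by
  simp [fanPos, h]

theorem int_le_add_one_of_cast {a b : ℤ} (h : (a : ℝ) ≤ b + 1) : a ≤ b + 1 := by
  exact_mod_cast h

theorem plane_ext {p q : Plane} (h0 : p 0 = q 0) (h1 : p 1 = q 1) : p = q := by
  ext i; fin_cases i <;> assumption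

theorem eq_fanPos {x v : V} {r : V → ℤ} (h : v ≠ x) {p : Plane} (h0 : p 0 = r v) (h1 : p 1 = 1) :
    p = fanPos x r v :=
  plane_ext (by rw [h0, fanPos_zero r h]) (by rw [h1, fanPos_one r h])

theorem of_mem_fanArc_hub {x u : V} {r : V → ℤ} (hu : u ≠ x) {p : Plane}
    (hp : p ∈ fanArc x r s(x, u)) : p 0 = p 1 * r u ∧ 0 ≤ p 1 ∧ p 1 ≤ 1 := by
  obtain ⟨a, b, ha, hb, hab, rfl⟩ := hp
  simp only [fanPos_hub, smul_zero, zero_add, PiLp.smul_apply, fanPos_zero r hu, fanPos_one r hu,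
    smul_eq_mul, mul_one, true_and]
  exact ⟨hb, by linarith⟩

theorem of_mem_fanArc_rim {x u v : V} {r : V → ℤ} (hu : u ≠ x) (hv : v ≠ x) (huv : r v = r u + 1)
    {p : Plane} (hp : p ∈ fanArc x r s(u, v)) : p 1 = 1 ∧ r u ≤ p 0 ∧ p 0 ≤ r u + 1 := by
  obtain ⟨a, b, ha, hb, hab, rfl⟩ := hp
  simp only [PiLp.add_apply, PiLp.smul_apply, fanPos_zero r hu, fanPos_one r hu,
    fanPos_zero r hv, fanPos_one r hv, smul_eq_mul, mul_one, huv]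
  push_cast
  have e : a * (r u : ℝ) + b * (r u + 1) = r u + b := by
    have : a = 1 - b := by linarith
    rw [this]; ring
  rw [e]
  exact ⟨hab, by linarith, by linarith⟩

theorem fanPos_injective {x : V} {r : V → ℤ} (hr : ∀ u v, u ≠ x → v ≠ x → r u = r v → u = v) :
    Function.Injective (fanPos x r) := by
  intro u v huv
  by_cases hu : u = x <;> by_cases hv : v = x
  · rw [hu, hv]
  · have := congrArg (fun p : Plane => p 1) huv
    simp [hu, fanPos_hub, fanPos_one r hv] at this
  · have := congrArg (fun p : Plane => p 1) huv
    simp [hv, fanPos_hub, fanPos_one r hu] at this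
  · have := congrArg (fun p : Plane => p 0) huv
    simp only [fanPos_zero r hu, fanPos_zero r hv] at this
    exact hr u v hu hv (by exact_mod_cast this)

theorem edge_cases {G : SimpleGraph V} {x : V} {r : V → ℤ}
    (hG : ∀ u v, G.Adj u v → u = x ∨ v = x ∨ |r u - r v| = 1) {e : Sym2 V} (he : e ∈ G.edgeSet) :
    (∃ u, u ≠ x ∧ e = s(x, u)) ∨ ∃ u v, u ≠ x ∧ v ≠ x ∧ r v = r u + 1 ∧ e = s(u, v) := by
  induction e with | _ u v
  have huv : G.Adj u v := he
  by_cases hu : u = x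
  · subst hu
    exact Or.inl ⟨v, huv.ne', rfl⟩
  by_cases hv : v = x
  · subst hv
    exact Or.inl ⟨u, huv.ne, Sym2.eq_swap⟩
  right
  rcases (abs_eq zero_le_one).1 (((hG u v huv).resolve_left hu).resolve_left hv) with h | h
  · exact ⟨v, u, hv, hu, by omega, Sym2.eq_swap⟩
  · exact ⟨u, v, hu, hv, by omega, rfl⟩

/-- The straight-line drawing of a subgraph of a fan. -/
noncomputable def fanDrawing (G : SimpleGraph V) {x : V} {r : V → ℤ}
    (hr : ∀ u v, u ≠ x → v ≠ x → r u = r v → u = v)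
    (hG : ∀ u v, G.Adj u v → u = x ∨ v = x ∨ |r u - r v| = 1) : PlaneDrawing G where
  pos := fanPos x r
  pos_injective := fanPos_injective hr
  arc := fanArc x r
  isArc u v huv := by
    have hne : fanPos x r u ≠ fanPos x r v := fun h => huv.ne (fanPos_injective hr h)
    refine ⟨Path.segment _ _, ?_, Path.range_segment _ _⟩
    intro s t hst
    rw [Path.segment_apply, Path.segment_apply] at hst
    exact Subtype.ext (AffineMap.lineMap_injective ℝ hne hst)
  vertex_of_mem_arc e he w hw := by
    rcases edge_cases hG he with ⟨u, hu, rfl⟩ | ⟨u, v, hu, hv, huv, rfl⟩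
    · by_cases hwx : w = x
      · simp [hwx]
      · have h := (of_mem_fanArc_hub hu hw).1
        rw [fanPos_zero r hwx, fanPos_one r hwx, one_mul] at h
        rw [hr w u hwx hu (Int.cast_injective (α := ℝ) h)]
        simp
    · obtain ⟨h1, h2, h3⟩ := of_mem_fanArc_rim hu hv huv hw
      have hwx : w ≠ x := by
        rintro rfl
        simp [fanPos_hub] at h1
      rw [fanPos_zero r hwx] at h2 h3
      have h2' : r u ≤ r w := Int.cast_le (R := ℝ).1 h2
      have h3' : r w ≤ r u + 1 := int_le_add_one_of_cast h3
      rcases h2'.eq_or_lt with h | h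
      · rw [← hr u w hu hwx h]; simp
      · rw [hr w v hwx hv (by omega)]; simp
  common_end e he f hf hef p hp := by
    obtain ⟨hpe, hpf⟩ := hp
    have mixed : ∀ {w u v : V}, w ≠ x → u ≠ x → v ≠ x → r v = r u + 1 →
        p ∈ fanArc x r s(x, w) → p ∈ fanArc x r s(u, v) →
        (w = u ∨ w = v) ∧ fanPos x r w = p := by
      intro w u v hw hu hv huv h h'
      obtain ⟨h0, -, -⟩ := of_mem_fanArc_hub hw h
      obtain ⟨h1, h2, h3⟩ := of_mem_fanArc_rim hu hv huv h'
      rw [h1, one_mul] at h0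
      rw [h0] at h2 h3
      have h2' : r u ≤ r w := Int.cast_le (R := ℝ).1 h2
      have h3' : r w ≤ r u + 1 := int_le_add_one_of_cast h3
      refine ⟨?_, (eq_fanPos hw h0 h1).symm⟩
      rcases h2'.eq_or_lt with h | h
      · exact Or.inl (hr w u hw hu h.symm)
      · exact Or.inr (hr w v hw hv (by omega))
    have rim : ∀ {u v u' v' : V}, u ≠ x → v ≠ x → u' ≠ x → v' ≠ x → r v = r u + 1 →
        r v' = r u' + 1 → p ∈ fanArc x r s(u, v) → p ∈ fanArc x r s(u', v') → r u < r u' →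
        v = u' ∧ fanPos x r v = p := by
      intro u v u' v' hu hv hu' hv' huv huv' h h' hlt
      obtain ⟨h1, h2, h3⟩ := of_mem_fanArc_rim hu hv huv h
      obtain ⟨-, h2', h3'⟩ := of_mem_fanArc_rim hu' hv' huv' h'
      have h4 : r u' ≤ r u + 1 := int_le_add_one_of_cast (h2'.trans h3)
      have h5 : r u' = r v := by omega
      have h6 : p 0 = r v := by
        rw [h5, huv] at h2'
        rw [huv]
        push_cast at h2' ⊢
        linarith
      exact ⟨hr v u' hv hu' h5.symm, (eq_fanPos hv h6 h1).symm⟩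
    rcases edge_cases hG he with ⟨u, hu, rfl⟩ | ⟨u, v, hu, hv, huv, rfl⟩ <;>
      rcases edge_cases hG hf with ⟨u', hu', rfl⟩ | ⟨u', v', hu', hv', huv', rfl⟩
    · refine ⟨x, by simp, by simp, ?_⟩
      obtain ⟨h0, -, -⟩ := of_mem_fanArc_hub hu hpe
      obtain ⟨h0', -, -⟩ := of_mem_fanArc_hub hu' hpf
      have hne : (r u : ℝ) ≠ r u' := fun h => hef (by
        rw [hr u u' hu hu' (by exact_mod_cast h)])
      have h1 : p 1 = 0 := by
        by_contra h
        exact hne (mul_left_cancel₀ h (h0.symm.trans h0'))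
      rw [fanPos_hub]
      exact plane_ext (by simp [h0, h1]) (by simp [h1])
    · obtain ⟨h, hp⟩ := mixed hu hu' hv' huv' hpe hpf
      exact ⟨u, by simp, by simpa using h, hp⟩
    · obtain ⟨h, hp⟩ := mixed hu' hu hv huv hpf hpe
      exact ⟨u', by simpa using h, by simp, hp⟩
    · rcases lt_trichotomy (r u) (r u') with h | h | h
      · obtain ⟨rfl, hp⟩ := rim hu hv hu' hv' huv huv' hpe hpf h
        exact ⟨v, by simp, by simp, hp⟩
      · exact absurd (by rw [hr u u' hu hu' h, hr v v' hv hv' (by omega)]) hef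
      · obtain ⟨rfl, hp⟩ := rim hu' hv' hu hv huv' huv hpf hpe h
        exact ⟨v', by simp, by simp, hp⟩

theorem PlaneDrawing.subset_outerFace {G : SimpleGraph V} (D : PlaneDrawing G) {S : Set Plane}
    (hS : IsPreconnected S) (hSD : S ⊆ D.imageᶜ) (hb : ¬ IsBounded S) : S ⊆ D.outerFace :=
  fun _ hp => ⟨hSD hp, fun h => hb (h.subset (hS.subset_connectedComponentIn hp hSD))⟩

theorem not_isBounded_of_forall_exists {S : Set Plane} (h : ∀ R : ℝ, ∃ p ∈ S, R < |p 1|) :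
    ¬ IsBounded S := by
  intro hb
  obtain ⟨R, hR⟩ := hb.subset_closedBall 0
  obtain ⟨p, hp, hpR⟩ := h R
  have h1 : ‖p‖ ≤ R := by simpa using hR hp
  have h2 : ‖p 1‖ ≤ ‖p‖ := PiLp.norm_apply_le p 1
  rw [Real.norm_eq_abs] at h2
  linarith

/-- A graph all of whose edges not at `x` join consecutive vertices on a line is outerplanar. -/
theorem isOuterplanar_of_fan (G : SimpleGraph V) {x : V} {r : V → ℤ}
    (hr : ∀ u v, u ≠ x → v ≠ x → r u = r v → u = v)
    (hG : ∀ u v, G.Adj u v → u = x ∨ v = x ∨ |r u - r v| = 1) : IsOuterplanar G := by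
  refine ⟨fanDrawing G hr hG, fun v => ?_⟩
  set D := fanDrawing G hr hG
  -- The drawing lies in the strip of heights 0 to 1. The open half-planes above and below are
  -- outer, the hub is a limit of the lower one and every other vertex of the upper one.
  have himg : ∀ p ∈ D.image, 0 ≤ p 1 ∧ p 1 ≤ 1 := by
    rintro p (⟨w, rfl⟩ | hp)
    · change 0 ≤ fanPos x r w 1 ∧ fanPos x r w 1 ≤ 1
      by_cases hw : w = x
      · subst hw; simp [fanPos_hub]
      · simp [fanPos_one r hw]
    · simp only [mem_iUnion] at hp
      obtain ⟨e, he, hpe⟩ := hp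
      rcases edge_cases hG he with ⟨u, hu, rfl⟩ | ⟨u, v, hu, hv, huv, rfl⟩
      · exact (of_mem_fanArc_hub hu hpe).2
      · rw [(of_mem_fanArc_rim hu hv huv hpe).1]; norm_num
  have hproj : IsLinearMap ℝ fun p : Plane => p 1 := ⟨fun _ _ => rfl, fun _ _ => rfl⟩
  have hup : {p : Plane | 1 < p 1} ⊆ D.outerFace := by
    refine D.subset_outerFace (convex_halfSpace_gt hproj 1).isPreconnected
      (fun p hp hpi => absurd (himg p hpi).2 (not_le.2 hp)) (not_isBounded_of_forall_exists ?_)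
    intro R
    refine ⟨!₂[0, |R| + 2], ?_, ?_⟩
    · have := abs_nonneg R
      simp; linarith
    · have := le_abs_self R
      simp only [Matrix.cons_val_one, Matrix.cons_val_fin_one]
      exact lt_of_lt_of_le (by linarith) (le_abs_self _)
  have hdown : {p : Plane | p 1 < 0} ⊆ D.outerFace := by
    refine D.subset_outerFace (convex_halfSpace_lt hproj 0).isPreconnected
      (fun p hp hpi => absurd (himg p hpi).1 (not_le.2 hp)) (not_isBounded_of_forall_exists ?_)
    intro R
    refine ⟨!₂[0, -(|R| + 2)], ?_, ?_⟩
    · have := abs_nonneg R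
      simp; linarith
    · have := le_abs_self R
      simp only [Matrix.cons_val_one, Matrix.cons_val_fin_one, abs_neg]
      exact lt_of_lt_of_le (by linarith) (le_abs_self _)
  refine ⟨?_, fun h => (interior_subset h).1 (Or.inl ⟨v, rfl⟩)⟩
  rw [Metric.mem_closure_iff]
  intro ε hε
  by_cases hv : v = x
  · refine ⟨D.pos v + EuclideanSpace.single 1 (-(ε / 2)), hdown ?_, ?_⟩
    · have : D.pos v = 0 := by rw [hv]; exact fanPos_hub x r
      simp [this, hε]
    · rw [dist_self_add_right, PiLp.norm_single, norm_neg, Real.norm_eq_abs,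
        abs_of_pos (by positivity)]
      linarith
  · refine ⟨D.pos v + EuclideanSpace.single 1 (ε / 2), hup ?_, ?_⟩
    · have : D.pos v 1 = 1 := fanPos_one r hv
      simp [this, hε]
    · rw [dist_self_add_right, PiLp.norm_single, Real.norm_eq_abs,
        abs_of_pos (by positivity)]
      linarith

end OuterplanarSpread

/-! ### Acyclic graphs of maximum degree two as orders on a line. -/

namespace OuterplanarSpread

open Set

theorem exists_unique_neighbor_of_isAcyclic {W : Type*} [Finite W] [Nonempty W] {H : SimpleGraph W}
    (h : H.IsAcyclic) : ∃ v, ∀ a b, H.Adj v a → H.Adj v b → a = b := by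
  classical
  have := Fintype.ofFinite W
  obtain ⟨v₀⟩ := ‹Nonempty W›
  let C := H.connectedComponentMk v₀
  have hC : C.toSimpleGraph.IsTree := h.isTree_connectedComponent C
  have hmem : ∀ {v w}, v ∈ C → H.Adj v w → w ∈ C := fun hv hvw =>
    C.mem_supp_of_adj_mem_supp hv hvw
  rcases subsingleton_or_nontrivial C with hs | hn
  · refine ⟨v₀, fun a b ha hb => ?_⟩
    have hv₀ : v₀ ∈ C := rfl
    exact congrArg Subtype.val (hs.elim (⟨a, hmem hv₀ ha⟩ : C) ⟨b, hmem hv₀ hb⟩)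
  · obtain ⟨⟨v, hv⟩, hdeg⟩ := hC.exists_vert_degree_one_of_nontrivial
    obtain ⟨w, -, hw⟩ := SimpleGraph.degree_eq_one_iff_existsUnique_adj.1 hdeg
    refine ⟨v, fun a b ha hb => ?_⟩
    have h1 := hw ⟨a, hmem hv ha⟩ ha
    have h2 := hw ⟨b, hmem hv hb⟩ hb
    exact congrArg Subtype.val (h1.trans h2.symm)

variable {V : Type*}

/-- Remove a vertex v with at most one neighbour in s, place the others, and reinsert v beside its
neighbour, or beyond all the others if it has none. -/
theorem exists_line_order_on_finset [DecidableEq V] {F : SimpleGraph V} (hF : F.IsAcyclic)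
    (hdeg : ∀ u a b c, F.Adj u a → F.Adj u b → F.Adj u c → a = b ∨ a = c ∨ b = c) (s : Finset V) :
    ∃ r : V → ℤ, InjOn r s ∧ ∀ u ∈ s, ∀ v ∈ s, F.Adj u v → |r u - r v| = 1 := by
  induction hn : s.card generalizing s with
  | zero =>
    obtain rfl := Finset.card_eq_zero.1 hn
    exact ⟨0, by simp, by simp⟩
  | succ n ih =>
    have hne : s.Nonempty := Finset.card_pos.1 (by omega)
    have : Nonempty (s : Set V) := hne.to_subtype
    obtain ⟨⟨v, hvs⟩, hv⟩ := exists_unique_neighbor_of_isAcyclic (hF.induce (s : Set V))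
    have hv' : ∀ a ∈ s, ∀ b ∈ s, F.Adj v a → F.Adj v b → a = b := fun a ha b hb h1 h2 =>
      congrArg Subtype.val (hv ⟨a, ha⟩ ⟨b, hb⟩ h1 h2)
    obtain ⟨r, hr, hradj⟩ := ih (s.erase v) (by rw [Finset.card_erase_of_mem hvs]; omega)
    by_cases hu : ∃ u ∈ s, F.Adj v u
    · obtain ⟨u, hus, hvu⟩ := hu
      have hus' : u ∈ s.erase v := Finset.mem_erase.2 ⟨hvu.ne', hus⟩
      -- Besides v, the vertex u has at most one neighbour in s. A reflection of the line puts that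
      -- neighbour on the right of u.
      obtain ⟨ε, hε, hεu⟩ : ∃ ε : ℤ, (ε = 1 ∨ ε = -1) ∧
          ∀ w ∈ s.erase v, F.Adj u w → ε * r w = ε * r u + 1 := by
        by_cases hw : ∃ w ∈ s.erase v, F.Adj u w
        · obtain ⟨w, hws, huw⟩ := hw
          have hall : ∀ w' ∈ s.erase v, F.Adj u w' → w' = w := by
            intro w' hw' huw'
            rcases hdeg u v w w' hvu.symm huw huw' with h | h | h
            · exact absurd h.symm (Finset.ne_of_mem_erase hws)
            · exact absurd h.symm (Finset.ne_of_mem_erase hw')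
            · exact h.symm
          rcases (abs_eq zero_le_one).1 (hradj u hus' w hws huw) with h | h
          · exact ⟨-1, Or.inr rfl, fun w' hw' h' => by rw [hall w' hw' h']; omega⟩
          · exact ⟨1, Or.inl rfl, fun w' hw' h' => by rw [hall w' hw' h']; omega⟩
        · exact ⟨1, Or.inl rfl, fun w hws huw => absurd ⟨w, hws, huw⟩ hw⟩
      let q : V → ℤ := fun w => ε * r w
      have hq : InjOn q (s.erase v) := by
        intro a ha b hb hab
        refine hr ha hb ?_
        rcases hε with rfl | rfl <;> simpa [q] using hab
      have hqadj : ∀ a ∈ s.erase v, ∀ b ∈ s.erase v, F.Adj a b →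
          q a - q b = 1 ∨ q a - q b = -1 := by
        intro a ha b hb hab
        have := (abs_eq zero_le_one).1 (hradj a ha b hb hab)
        rcases hε with rfl | rfl <;> simp only [q] <;> omega
      have hqu : ∀ w ∈ s.erase v, F.Adj u w → q w = q u + 1 := hεu
      -- Everything left of u moves one step left, which frees the place just before u for v. No
      -- edge is stretched: by `hcross` none crosses this gap.
      let t : V → ℤ := fun w => if w = v then q u - 1 else if q w < q u then q w - 1 else q w
      have htv : t v = q u - 1 := if_pos rfl
      have ht : ∀ w ∈ s.erase v, t w = if q w < q u then q w - 1 else q w := fun w hw =>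
        if_neg (Finset.ne_of_mem_erase hw)
      have hsplit : ∀ w ∈ s, w = v ∨ w ∈ s.erase v := fun w hw => by
        by_cases h : w = v
        · exact Or.inl h
        · exact Or.inr (Finset.mem_erase.2 ⟨h, hw⟩)
      have hcross : ∀ a ∈ s.erase v, ∀ b ∈ s.erase v, F.Adj a b → q a < q u → q b < q u := by
        intro a ha b hb hab hlt
        by_contra hge
        have h1 := hqadj a ha b hb hab
        have h2 : q b = q u := by omega
        have h3 := hq hb hus' h2
        subst h3
        have := hqu a ha hab.symm
        omega
      refine ⟨t, ?_, ?_⟩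
      · intro a ha b hb hab
        rcases hsplit a ha with rfl | ha' <;> rcases hsplit b hb with rfl | hb'
        · rfl
        · rw [htv, ht b hb'] at hab
          split_ifs at hab <;> omega
        · rw [htv, ht a ha'] at hab
          split_ifs at hab <;> omega
        · rw [ht a ha', ht b hb'] at hab
          refine hq ha' hb' ?_
          split_ifs at hab <;> omega
      · intro a ha b hb hab
        rw [abs_eq zero_le_one]
        rcases hsplit a ha with rfl | ha' <;> rcases hsplit b hb with rfl | hb'
        · exact absurd rfl hab.ne
        · obtain rfl := hv' b hb u hus hab hvu
          rw [htv, ht b hb']; simp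
        · obtain rfl := hv' a ha u hus hab.symm hvu
          rw [htv, ht a ha']; simp
        · rw [ht a ha', ht b hb']
          have h1 := hqadj a ha' b hb' hab
          have h2 := hcross a ha' b hb' hab
          have h3 := hcross b hb' a ha' hab.symm
          split_ifs <;> omega
    · push Not at hu
      let M : ℤ := 1 + ∑ w ∈ s.erase v, |r w|
      have hM : ∀ w ∈ s.erase v, r w < M := by
        intro w hw
        have h1 := Finset.single_le_sum (f := fun w => |r w|) (fun i _ => abs_nonneg _) hw
        have h2 := le_abs_self (r w)
        simp only [M]
        omega
      refine ⟨Function.update r v M, ?_, ?_⟩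
      · intro a ha b hb hab
        by_cases hav : a = v <;> by_cases hbv : b = v
        · rw [hav, hbv]
        · subst hav
          rw [Function.update_self, Function.update_of_ne hbv] at hab
          exact absurd hab (hM b (Finset.mem_erase.2 ⟨hbv, hb⟩)).ne'
        · subst hbv
          rw [Function.update_self, Function.update_of_ne hav] at hab
          exact absurd hab (hM a (Finset.mem_erase.2 ⟨hav, ha⟩)).ne
        · rw [Function.update_of_ne hav, Function.update_of_ne hbv] at hab
          exact hr (Finset.mem_erase.2 ⟨hav, ha⟩) (Finset.mem_erase.2 ⟨hbv, hb⟩) hab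
      · intro a ha b hb hab
        by_cases hav : a = v
        · subst hav; exact absurd hab (hu b hb)
        by_cases hbv : b = v
        · subst hbv; exact absurd hab.symm (hu a ha)
        rw [Function.update_of_ne hav, Function.update_of_ne hbv]
        exact hradj a (Finset.mem_erase.2 ⟨hav, ha⟩) b (Finset.mem_erase.2 ⟨hbv, hb⟩) hab

/-- The vertices of a finite linear forest can be put on a line such that adjacent vertices are
consecutive. -/
theorem exists_line_order [Fintype V] {F : SimpleGraph V} (hF : F.IsAcyclic)
    (hdeg : ∀ u a b c, F.Adj u a → F.Adj u b → F.Adj u c → a = b ∨ a = c ∨ b = c) :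
    ∃ r : V → ℤ, Function.Injective r ∧ ∀ u v, F.Adj u v → |r u - r v| = 1 := by
  classical
  obtain ⟨r, hr, hadj⟩ := exists_line_order_on_finset hF hdeg Finset.univ
  exact ⟨r, fun a b h => hr (by simp) (by simp) h, fun u v h => hadj u (by simp) v (by simp) h⟩

/-- Sorting a component by position identifies it with a path: edges have length 1, so they cannot
skip a vertex, and connectedness leaves no consecutive pair unjoined. -/
theorem isLinearForest_of_line_order [Finite V] {F : SimpleGraph V} {r : V → ℤ}
    (hr : Function.Injective r) (hF : ∀ u v, F.Adj u v → |r u - r v| = 1) : IsLinearForest F := by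
  classical
  have := Fintype.ofFinite V
  intro C
  let q : C → ℤ := fun v => r v
  have hq : Function.Injective q := hr.comp Subtype.val_injective
  let S : Finset ℤ := Finset.univ.image q
  let e₁ : Fin S.card ≃o S := S.orderIsoOfFin rfl
  let e₂ : C ≃ S := Equiv.ofBijective (fun v => ⟨q v, by simp [S]⟩)
    ⟨fun a b h => hq (congrArg Subtype.val h), fun ⟨z, hz⟩ => by
      obtain ⟨v, -, hv⟩ := Finset.mem_image.1 hz
      exact ⟨v, Subtype.ext hv⟩⟩
  let e : Fin S.card ≃ C := e₁.toEquiv.trans e₂.symm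
  have hqe : ∀ i, q (e i) = (e₁ i : ℤ) := fun i =>
    congrArg Subtype.val (e₂.apply_symm_apply (e₁ i))
  have hmono : ∀ i j, i < j → q (e i) < q (e j) := fun i j hij => by
    rw [hqe, hqe]; exact e₁.strictMono hij
  have hadj : ∀ a b : C, C.toSimpleGraph.Adj a b → |q a - q b| = 1 := fun a b h => hF _ _ h
  have hnext : ∀ i j, i < j → C.toSimpleGraph.Adj (e i) (e j) → i.val + 1 = j.val := by
    intro i j hij h
    by_contra hne
    have hlt : i.val + 1 < j.val := by
      have : i.val < j.val := hij
      omega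
    have h1 := hmono i ⟨i.val + 1, hlt.trans j.2⟩ (Fin.lt_def.2 (Nat.lt_succ_self _))
    have h2 := hmono ⟨i.val + 1, hlt.trans j.2⟩ j hlt
    have h3 := (abs_eq zero_le_one).1 (hadj _ _ h)
    omega
  have hstep : ∀ i j, i.val + 1 = j.val → C.toSimpleGraph.Adj (e i) (e j) := by
    intro i j hij
    obtain ⟨W⟩ := C.connected_toSimpleGraph.preconnected (e i) (e j)
    -- Some edge of the walk leaves the initial segment up to i; an edge joins consecutive vertices,
    -- so it is the edge from i to j.
    obtain ⟨d, -, h1, h2⟩ := W.exists_boundary_dart {v | e.symm v ≤ i} (by simp)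
      (by simp only [mem_ofPred_eq, Equiv.symm_apply_apply, not_le]; exact Fin.lt_def.2 (by omega))
    obtain ⟨a, ha⟩ := e.surjective d.fst
    obtain ⟨b, hb⟩ := e.surjective d.snd
    have hd := d.adj
    simp only [mem_ofPred_eq, ← ha, ← hb, Equiv.symm_apply_apply, not_le] at h1 h2 hd
    have h3 := hnext a b (h1.trans_lt h2) hd
    have h4 : a.val ≤ i.val := h1
    have h5 : i.val < b.val := h2
    have h6 : a = i := Fin.ext (by omega)
    have h7 : b = j := Fin.ext (by omega)
    rwa [h6, h7] at hd
  refine ⟨S.card, ⟨⟨e.symm, ?_⟩⟩⟩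
  intro a b
  obtain ⟨i, rfl⟩ := e.surjective a
  obtain ⟨j, rfl⟩ := e.surjective b
  rw [Equiv.symm_apply_apply, Equiv.symm_apply_apply, SimpleGraph.pathGraph_adj]
  constructor
  · rintro (h | h)
    · exact hstep i j h
    · exact (hstep j i h).symm
  · intro h
    rcases lt_trichotomy i j with hij | hij | hij
    · exact Or.inl (hnext i j hij h)
    · exact absurd (congrArg e hij) h.ne
    · exact Or.inr (hnext j i hij h.symm)

end OuterplanarSpread

/-! ### Variational description of the spread. -/

namespace OuterplanarSpread

open Set

variable {V : Type*} [Fintype V]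

open Classical in
/-- The sum of `f` over the neighbours of `v`. -/
noncomputable def neighborSum (G : SimpleGraph V) (f : V → ℝ) (v : V) : ℝ :=
  ∑ w, if G.Adj v w then f w else 0

/-- The bilinear form of the adjacency matrix. -/
noncomputable def adjForm (G : SimpleGraph V) (f g : V → ℝ) : ℝ := ∑ v, f v * neighborSum G g v

theorem adjForm_comm (G : SimpleGraph V) (f g : V → ℝ) : adjForm G f g = adjForm G g f := by
  classical
  simp only [adjForm, neighborSum, Finset.mul_sum]
  rw [Finset.sum_comm]
  refine Finset.sum_congr rfl fun v _ => Finset.sum_congr rfl fun w _ => ?_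
  simp only [G.adj_comm w v]
  split_ifs <;> ring

/-- `ρ` is the largest eigenvalue of `ε` times the adjacency matrix of `G`. -/
structure IsTopEigenvalue (G : SimpleGraph V) (ε ρ : ℝ) : Prop where
  exists_eigenvector : ∃ f : V → ℝ, f ≠ 0 ∧ ∀ v, ε * neighborSum G f v = ρ * f v
  form_le : ∀ f : V → ℝ, ε * adjForm G f f ≤ ρ * ∑ v, f v ^ 2

open Classical in
theorem neighborSum_eq_mulVec (G : SimpleGraph V) (f : V → ℝ) (v : V) :
    neighborSum G f v = ((G.adjMatrix ℝ).mulVec f) v := by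
  rw [neighborSum, SimpleGraph.adjMatrix_mulVec_apply, ← Finset.sum_filter]
  refine Finset.sum_congr ?_ fun _ _ => rfl
  ext w
  simp

open Classical in
theorem adjForm_eq_sum_eigenvalues (G : SimpleGraph V) (f : V → ℝ) :
    adjForm G f f = ∑ i, (isHermitian_adjMatrix G).eigenvalues i *
      (inner ℝ ((isHermitian_adjMatrix G).eigenvectorBasis i) (WithLp.toLp 2 f)) ^ 2 := by
  set hA := isHermitian_adjMatrix G
  have hi : ∀ g h : V → ℝ, inner ℝ (WithLp.toLp 2 g) (WithLp.toLp 2 h) = ∑ v, g v * h v := by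
    intro g h
    simp [PiLp.inner_apply, mul_comm]
  have h1 : adjForm G f f = inner ℝ (WithLp.toLp 2 f)
      (WithLp.toLp 2 (fun v => neighborSum G f v)) := by
    rw [hi]; rfl
  rw [h1, ← hA.eigenvectorBasis.sum_inner_mul_inner]
  refine Finset.sum_congr rfl fun i _ => ?_
  have h2 : inner ℝ (hA.eigenvectorBasis i) (WithLp.toLp 2 (fun v => neighborSum G f v)) =
      hA.eigenvalues i * inner ℝ (hA.eigenvectorBasis i) (WithLp.toLp 2 f) := by
    have e : hA.eigenvectorBasis i = WithLp.toLp 2 (hA.eigenvectorBasis i : V → ℝ) := rfl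
    rw [e, hi, hi, Finset.mul_sum]
    have h3 := adjForm_comm G (hA.eigenvectorBasis i : V → ℝ) f
    rw [adjForm, adjForm] at h3
    rw [h3]
    refine Finset.sum_congr rfl fun v _ => ?_
    rw [neighborSum_eq_mulVec, hA.mulVec_eigenvectorBasis]
    simp only [Pi.smul_apply, smul_eq_mul]
    ring
  rw [h2, real_inner_comm]
  ring

open Classical in
theorem sum_sq_eq_sum_inner (G : SimpleGraph V) (f : V → ℝ) :
    ∑ v, f v ^ 2 = ∑ i,
      (inner ℝ ((isHermitian_adjMatrix G).eigenvectorBasis i) (WithLp.toLp 2 f)) ^ 2 := by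
  have h := (isHermitian_adjMatrix G).eigenvectorBasis.sum_inner_mul_inner
    (WithLp.toLp 2 f) (WithLp.toLp 2 f)
  have h1 : inner ℝ (WithLp.toLp 2 f) (WithLp.toLp 2 f) = ∑ v, f v ^ 2 := by
    rw [PiLp.inner_apply]
    exact Finset.sum_congr rfl fun v _ => by rw [RCLike.inner_apply, conj_trivial, sq]
  rw [← h1, ← h]
  refine Finset.sum_congr rfl fun i _ => ?_
  rw [real_inner_comm (WithLp.toLp 2 f), sq]

open Classical in
theorem exists_eigenvector_eigenvalues (G : SimpleGraph V) (i : V) :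
    ∃ f : V → ℝ, f ≠ 0 ∧
      ∀ v, neighborSum G f v = (isHermitian_adjMatrix G).eigenvalues i * f v := by
  set hA := isHermitian_adjMatrix G
  refine ⟨hA.eigenvectorBasis i, fun h => ?_, fun v => ?_⟩
  · refine hA.eigenvectorBasis.orthonormal.ne_zero i ?_
    ext v
    exact congrFun h v
  · rw [neighborSum_eq_mulVec, hA.mulVec_eigenvectorBasis]; rfl

/-- Taking ρ₂ as minus the least eigenvalue lets both ends of the spectrum be treated alike, with a
sign ε. The form bounds follow from the expansion in an orthonormal eigenbasis. -/
theorem exists_topEigenvalues [Nonempty V] (G : SimpleGraph V) :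
    ∃ ρ₁ ρ₂, spread G = ρ₁ + ρ₂ ∧ IsTopEigenvalue G 1 ρ₁ ∧ IsTopEigenvalue G (-1) ρ₂ := by
  classical
  set hA := isHermitian_adjMatrix G
  obtain ⟨i, hi⟩ := exists_eq_ciSup_of_finite (f := hA.eigenvalues)
  obtain ⟨j, hj⟩ := exists_eq_ciInf_of_finite (f := hA.eigenvalues)
  have hle : ∀ k, hA.eigenvalues k ≤ hA.eigenvalues i := fun k => by
    rw [hi]; exact le_ciSup (finite_range _).bddAbove k
  have hge : ∀ k, hA.eigenvalues j ≤ hA.eigenvalues k := fun k => by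
    rw [hj]; exact ciInf_le (finite_range _).bddBelow k
  refine ⟨hA.eigenvalues i, -hA.eigenvalues j, ?_, ⟨?_, fun f => ?_⟩, ⟨?_, fun f => ?_⟩⟩
  · rw [hi, hj, ← sub_eq_add_neg]
    unfold spread
    congr!
  · obtain ⟨f, hf, h⟩ := exists_eigenvector_eigenvalues G i
    exact ⟨f, hf, fun v => by rw [one_mul, h v]⟩
  · rw [one_mul, adjForm_eq_sum_eigenvalues, sum_sq_eq_sum_inner G, Finset.mul_sum]
    exact Finset.sum_le_sum fun k _ => mul_le_mul_of_nonneg_right (hle k) (sq_nonneg _)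
  · obtain ⟨f, hf, h⟩ := exists_eigenvector_eigenvalues G j
    exact ⟨f, hf, fun v => by rw [h v]; ring⟩
  · rw [adjForm_eq_sum_eigenvalues, sum_sq_eq_sum_inner G, Finset.mul_sum, Finset.mul_sum]
    refine Finset.sum_le_sum fun k _ => ?_
    have := mul_le_mul_of_nonneg_right (hge k) (sq_nonneg
      (inner ℝ ((isHermitian_adjMatrix G).eigenvectorBasis k) (WithLp.toLp 2 f)))
    linarith

/-- The largest eigenvalue has an eigenvector whose entry of largest modulus is `1`. -/
theorem IsTopEigenvalue.exists_normalized {G : SimpleGraph V} {ε ρ : ℝ}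
    (h : IsTopEigenvalue G ε ρ) : ∃ (x : V) (f : V → ℝ), f x = 1 ∧ (∀ v, |f v| ≤ 1) ∧
      ∀ v, ε * neighborSum G f v = ρ * f v := by
  obtain ⟨f, hf, hev⟩ := h.exists_eigenvector
  obtain ⟨v₀, hv₀⟩ := Function.ne_iff.1 hf
  have : Nonempty V := ⟨v₀⟩
  obtain ⟨x, hx⟩ := Finite.exists_max fun v => |f v|
  have hx0 : 0 < |f x| := (abs_pos.2 hv₀).trans_le (hx v₀)
  refine ⟨x, fun v => f v / f x, div_self (abs_pos.1 hx0), fun v => ?_, fun v => ?_⟩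
  · rw [abs_div, div_le_one hx0]
    exact hx v
  · have : neighborSum G (fun v => f v / f x) v = neighborSum G f v / f x := by
      simp only [neighborSum, Finset.sum_div]
      refine Finset.sum_congr rfl fun w _ => ?_
      split_ifs <;> simp
    rw [this, mul_div_assoc', hev v, mul_div_assoc]

end OuterplanarSpread

/-! ### Eigenvector estimates in sparse graphs. -/

namespace OuterplanarSpread

open Set

variable {V : Type*} [Fintype V] {G : SimpleGraph V}

/-- The degree of a vertex as a real number. -/
noncomputable def realDegree (G : SimpleGraph V) (v : V) : ℝ := neighborSum G (fun _ => 1) v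

open Classical in
/-- Two vertices have at most two common neighbours, and the number of edges is linear. -/
structure IsSparse (G : SimpleGraph V) : Prop where
  card_common_le : ∀ u v : V, u ≠ v →
    (Finset.univ.filter fun w => G.Adj u w ∧ G.Adj v w).card ≤ 2
  sum_degree_le : ∑ v, realDegree G v ≤ 6 * Fintype.card V

open Classical in
theorem realDegree_eq_card (G : SimpleGraph V) (v : V) :
    realDegree G v = (Finset.univ.filter fun w => G.Adj v w).card := by
  simp [realDegree, neighborSum]

theorem IsOuterplanar.isSparse (h : IsOuterplanar G) : IsSparse G := by
  classical
  obtain ⟨D⟩ := h.nonempty_outerDrawing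
  refine ⟨fun u v huv => D.card_common_neighbors_le_two huv, ?_⟩
  simp only [realDegree_eq_card]
  exact_mod_cast D.sum_card_neighbors_le

/-! ### Elementary properties of neighbour sums -/

theorem neighborSum_mono {f g : V → ℝ} {v : V} (h : ∀ w, G.Adj v w → f w ≤ g w) :
    neighborSum G f v ≤ neighborSum G g v := by
  refine Finset.sum_le_sum fun w _ => ?_
  split_ifs with hw
  · exact h w hw
  · exact le_rfl

theorem neighborSum_nonneg {f : V → ℝ} (h : ∀ w, 0 ≤ f w) (v : V) : 0 ≤ neighborSum G f v :=
  Finset.sum_nonneg fun w _ => by split_ifs <;> simp [h w]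

theorem abs_neighborSum_le (f : V → ℝ) (v : V) :
    |neighborSum G f v| ≤ neighborSum G (fun w => |f w|) v := by
  refine (Finset.abs_sum_le_sum_abs _ _).trans (Finset.sum_le_sum fun w _ => ?_)
  split_ifs <;> simp

theorem neighborSum_add (f g : V → ℝ) (v : V) :
    neighborSum G (fun w => f w + g w) v = neighborSum G f v + neighborSum G g v := by
  simp only [neighborSum, ← Finset.sum_add_distrib]
  refine Finset.sum_congr rfl fun w _ => ?_
  split_ifs <;> simp

theorem neighborSum_const_mul (c : ℝ) (f : V → ℝ) (v : V) :
    neighborSum G (fun w => c * f w) v = c * neighborSum G f v := by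
  simp only [neighborSum, Finset.mul_sum]
  refine Finset.sum_congr rfl fun w _ => ?_
  split_ifs <;> simp

theorem neighborSum_const (c : ℝ) (v : V) :
    neighborSum G (fun _ => c) v = c * realDegree G v := by
  rw [realDegree, ← neighborSum_const_mul]
  simp

theorem sum_neighborSum (g : V → ℝ) : ∑ v, neighborSum G g v = ∑ v, g v * realDegree G v := by
  have := adjForm_comm G (fun _ => 1) g
  simpa only [adjForm, one_mul, realDegree] using this

theorem IsSparse.neighborSum_common_le (hG : IsSparse G) {u v : V} (huv : u ≠ v) {f : V → ℝ}
    {c : ℝ} (hc : 0 ≤ c) (h₁ : ∀ w, G.Adj v w → f w ≤ c) (h₀ : ∀ w, ¬ G.Adj v w → f w ≤ 0) :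
    neighborSum G f u ≤ 2 * c := by
  classical
  calc neighborSum G f u ≤ ∑ w, if G.Adj u w ∧ G.Adj v w then c else 0 := by
        refine Finset.sum_le_sum fun w _ => ?_
        by_cases hu : G.Adj u w <;> by_cases hv : G.Adj v w <;> simp [hu, hv, h₁, h₀]
    _ = (Finset.univ.filter fun w => G.Adj u w ∧ G.Adj v w).card * c := by
        rw [← Finset.sum_filter, Finset.sum_const, nsmul_eq_mul]
    _ ≤ 2 * c := by
        refine mul_le_mul_of_nonneg_right ?_ hc
        exact_mod_cast hG.card_common_le u v huv

/-- The square of the adjacency matrix has the degrees on the diagonal and common-neighbour counts,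
at most 2, elsewhere. -/
theorem IsSparse.neighborSum_neighborSum_le (hG : IsSparse G) {g : V → ℝ} (hg : ∀ v, 0 ≤ g v)
    (v : V) : neighborSum G (neighborSum G g) v ≤ realDegree G v * g v + 2 * ∑ w, g w := by
  classical
  have h1 : neighborSum G (neighborSum G g) v =
      ∑ w, g w * neighborSum G (fun u => if G.Adj w u then 1 else 0) v := by
    simp only [neighborSum, Finset.mul_sum]
    rw [Finset.sum_comm]
    refine Finset.sum_congr rfl fun u _ => ?_
    split_ifs with h
    · simp [G.adj_comm]
    · simp
  have h2 : ∀ w, g w * neighborSum G (fun u => if G.Adj w u then 1 else 0) v ≤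
      (if w = v then realDegree G v * g v else 0) + 2 * g w := by
    intro w
    by_cases hw : w = v
    · subst hw
      have : neighborSum G (fun u => if G.Adj w u then (1 : ℝ) else 0) w = realDegree G w := by
        refine Finset.sum_congr rfl fun u _ => ?_
        split_ifs with h <;> simp [h]
      rw [this, if_pos rfl]
      have := hg w
      linarith
    · rw [if_neg hw, zero_add, mul_comm 2]
      refine mul_le_mul_of_nonneg_left ?_ (hg w)
      have := hG.neighborSum_common_le (u := v) (v := w) (Ne.symm hw)
        (f := fun u => if G.Adj w u then 1 else 0) zero_le_one (fun u hu => by simp [hu])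
        (fun u hu => by simp [hu])
      linarith
  rw [h1]
  refine (Finset.sum_le_sum fun w _ => h2 w).trans ?_
  rw [Finset.sum_add_distrib, Finset.sum_ite_eq' Finset.univ v, Finset.mul_sum]
  simp

/-! ### Estimates for eigenvectors -/

/-- `f` is an eigenvector of `ε` times the adjacency matrix for `ρ > 0`, and its entry of largest
modulus is the entry `1` at `x`. -/
structure IsNormalizedEigenvector (G : SimpleGraph V) (ε ρ : ℝ) (x : V) (f : V → ℝ) : Prop where
  eps : ε = 1 ∨ ε = -1
  pos : 0 < ρ
  apply_eq_one : f x = 1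
  abs_le_one : ∀ v, |f v| ≤ 1
  eigen : ∀ v, ε * neighborSum G f v = ρ * f v

namespace IsNormalizedEigenvector

variable {ε ρ : ℝ} {x : V} {f : V → ℝ}

theorem abs_eps (h : IsNormalizedEigenvector G ε ρ x f) : |ε| = 1 := by
  rcases h.eps with h | h <;> simp [h]

theorem eps_mul_eps (h : IsNormalizedEigenvector G ε ρ x f) : ε * ε = 1 := by
  rcases h.eps with h | h <;> simp [h]

theorem mul_abs_le (h : IsNormalizedEigenvector G ε ρ x f) (v : V) :
    ρ * |f v| ≤ neighborSum G (fun w => |f w|) v := by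
  have h1 : |ε * neighborSum G f v| = ρ * |f v| := by
    rw [h.eigen, abs_mul, abs_of_pos h.pos]
  rw [abs_mul, h.abs_eps, one_mul] at h1
  rw [← h1]
  exact abs_neighborSum_le f v

/-- Summing the eigenvalue inequality weights each |f v| ≤ 1 by its degree, and the degree sum is at
most 6n. -/
theorem mul_sum_abs_le (h : IsNormalizedEigenvector G ε ρ x f) (hG : IsSparse G) :
    ρ * ∑ v, |f v| ≤ 6 * Fintype.card V := by
  rw [Finset.mul_sum]
  refine (Finset.sum_le_sum fun v _ => h.mul_abs_le v).trans ?_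
  rw [sum_neighborSum]
  refine le_trans (Finset.sum_le_sum fun v _ => ?_) hG.sum_degree_le
  exact mul_le_of_le_one_left (neighborSum_nonneg (fun _ => zero_le_one) v) (h.abs_le_one v)

theorem sq_mul_abs_le (h : IsNormalizedEigenvector G ε ρ x f) (hG : IsSparse G) (v : V) :
    ρ ^ 2 * |f v| ≤ realDegree G v * |f v| + 2 * ∑ w, |f w| := by
  refine le_trans ?_ (hG.neighborSum_neighborSum_le (fun v => abs_nonneg (f v)) v)
  calc ρ ^ 2 * |f v| = ρ * (ρ * |f v|) := by ring
    _ ≤ ρ * neighborSum G (fun w => |f w|) v :=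
        mul_le_mul_of_nonneg_left (h.mul_abs_le v) h.pos.le
    _ = neighborSum G (fun w => ρ * |f w|) v := (neighborSum_const_mul _ _ _).symm
    _ ≤ _ := neighborSum_mono fun w _ => h.mul_abs_le w

/-- The squared eigenvalue inequality at the entry 1, multiplied by ρ so that ρ Σ|f| ≤ 6n applies.
-/
theorem cube_le (h : IsNormalizedEigenvector G ε ρ x f) (hG : IsSparse G) :
    ρ ^ 3 ≤ ρ * realDegree G x + 12 * Fintype.card V := by
  have h1 := h.sq_mul_abs_le hG x
  rw [h.apply_eq_one, abs_one, mul_one, mul_one] at h1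
  have h2 := mul_le_mul_of_nonneg_left h1 h.pos.le
  have h3 := h.mul_sum_abs_le hG
  nlinarith

theorem _root_.OuterplanarSpread.realDegree_le_card (v : V) :
    realDegree G v ≤ Fintype.card V := by
  classical
  rw [realDegree_eq_card]
  exact_mod_cast Finset.card_le_univ _

/-- If ρ exceeded s + 6, the error 12n/ρ would be at most 12s, and ρ² ≤ s² + 12s < (s + 6)² would
follow. -/
theorem le_add_six (h : IsNormalizedEigenvector G ε ρ x f) (hG : IsSparse G) {s : ℝ} (hs : 0 < s)
    (hsn : s ^ 2 = Fintype.card V) : ρ ≤ s + 6 := by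
  by_contra! hlt
  have h1 := h.cube_le hG
  have h2 := mul_le_mul_of_nonneg_left (realDegree_le_card (G := G) x) h.pos.le
  rw [← hsn] at h1 h2
  have h3 : 12 * s ^ 2 ≤ ρ * (12 * s) := by nlinarith
  have h4 : ρ ^ 2 ≤ s ^ 2 + 12 * s := by
    refine le_of_mul_le_mul_left ?_ h.pos
    nlinarith
  nlinarith

/-- Since ρ ≥ s/2, the error 12n/ρ is at most 24s; together with the 16s lost in (s - 8)² this makes
40s. -/
theorem le_realDegree (h : IsNormalizedEigenvector G ε ρ x f) (hG : IsSparse G) {s : ℝ}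
    (hs : 100 ≤ s) (hsn : s ^ 2 = Fintype.card V) (hρ : s - 8 ≤ ρ) :
    s ^ 2 - 40 * s ≤ realDegree G x := by
  have h1 := h.cube_le hG
  rw [← hsn] at h1
  have h2 : 12 * s ^ 2 ≤ ρ * (24 * s) := by nlinarith
  have h3 : ρ ^ 2 ≤ realDegree G x + 24 * s := by
    refine le_of_mul_le_mul_left ?_ h.pos
    nlinarith
  nlinarith

end IsNormalizedEigenvector

/-- `x` is adjacent to all but at most `40 √n` vertices. -/
structure IsHub (G : SimpleGraph V) (x : V) (s : ℝ) : Prop where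
  large : 10 ^ 7 ≤ s
  sq_eq : s ^ 2 = Fintype.card V
  le_degree : s ^ 2 - 40 * s ≤ realDegree G x

/-- Two hubs would have almost n common neighbours. -/
theorem IsSparse.hub_unique (hG : IsSparse G) {x y : V} {s : ℝ} (hx : IsHub G x s)
    (hy : IsHub G y s) : x = y := by
  classical
  by_contra hxy
  have h1 : (realDegree G x + realDegree G y) ≤ Fintype.card V + 2 := by
    have hc := hG.card_common_le x y hxy
    have hu := Finset.card_union_add_card_inter (Finset.univ.filter fun w => G.Adj x w)
      (Finset.univ.filter fun w => G.Adj y w)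
    rw [← Finset.filter_and] at hu
    have hn := Finset.card_le_univ
      ((Finset.univ.filter fun w => G.Adj x w) ∪ (Finset.univ.filter fun w => G.Adj y w))
    rw [realDegree_eq_card, realDegree_eq_card]
    exact_mod_cast (by omega)
  have h2 := hx.le_degree
  have h3 := hy.le_degree
  rw [← hx.sq_eq] at h1
  nlinarith [hx.large]

open Classical in
/-- The indicator function of the vertices other than `x` that are not adjacent to `x`. -/
noncomputable def nonneighbor {W : Type*} (G : SimpleGraph W) (x : W) (v : W) : ℝ :=
  if v = x ∨ G.Adj x v then 0 else 1

theorem nonneighbor_mul_self {W : Type*} {G : SimpleGraph W} (x v : W) :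
    nonneighbor G x v * nonneighbor G x v = nonneighbor G x v := by
  rw [nonneighbor]; split_ifs <;> simp

theorem nonneighbor_nonneg {W : Type*} {G : SimpleGraph W} (x v : W) : 0 ≤ nonneighbor G x v := by
  rw [nonneighbor]; split_ifs <;> simp

theorem nonneighbor_of_mem {W : Type*} {G : SimpleGraph W} {x v : W} (h : v = x ∨ G.Adj x v) :
    nonneighbor G x v = 0 := if_pos h

theorem nonneighbor_of_notMem {W : Type*} {G : SimpleGraph W} {x v : W}
    (h : ¬ (v = x ∨ G.Adj x v)) : nonneighbor G x v = 1 :=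
  if_neg h

theorem sum_nonneighbor_le (x : V) :
    ∑ v, nonneighbor G x v ≤ Fintype.card V - realDegree G x := by
  classical
  have : ∀ v, nonneighbor G x v ≤ 1 - if G.Adj x v then (1 : ℝ) else 0 := by
    intro v
    rw [nonneighbor]
    by_cases h1 : v = x <;> by_cases h2 : G.Adj x v <;> simp [h1, h2]
  refine (Finset.sum_le_sum fun v _ => this v).trans ?_
  rw [Finset.sum_sub_distrib]
  simp [realDegree, neighborSum]

namespace IsHub

variable {x : V} {s : ℝ}

theorem sum_nonneighbor_le (hx : IsHub G x s) : ∑ v, nonneighbor G x v ≤ 40 * s := by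
  have h1 := OuterplanarSpread.sum_nonneighbor_le (G := G) x
  have h2 := hx.le_degree
  rw [← hx.sq_eq] at h1
  linarith

/-- At most two neighbours of v are adjacent to the hub, and at most 40s vertices are not. -/
theorem realDegree_le (hx : IsHub G x s) (hG : IsSparse G) {v : V} (hv : v ≠ x) :
    realDegree G v ≤ 41 * s := by
  classical
  have h1 : realDegree G v ≤ neighborSum G (fun w => if G.Adj x w then 1 else 0) v +
      ∑ w, (1 - if G.Adj x w then (1 : ℝ) else 0) := by
    rw [realDegree, neighborSum, neighborSum, ← Finset.sum_add_distrib]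
    refine Finset.sum_le_sum fun w _ => ?_
    by_cases h1 : G.Adj v w <;> by_cases h2 : G.Adj x w <;> simp [h1, h2]
  have h2 : ∑ w, (1 - if G.Adj x w then (1 : ℝ) else 0) = Fintype.card V - realDegree G x := by
    rw [Finset.sum_sub_distrib]
    simp [realDegree, neighborSum]
  have h3 := hG.neighborSum_common_le hv (f := fun w => if G.Adj x w then 1 else 0)
    zero_le_one (fun w hw => by simp [hw]) (fun w hw => by simp [hw])
  have h4 := hx.le_degree
  have h5 := hx.large
  rw [← hx.sq_eq] at h2
  linarith

variable {ε ρ : ℝ} {f : V → ℝ}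

/-- From ρ ≥ s/2 one gets Σ|f| ≤ 12s, and then s²|f v|/4 ≤ 41s + 24s. -/
theorem mul_abs_le (hx : IsHub G x s) (hG : IsSparse G) (h : IsNormalizedEigenvector G ε ρ x f)
    (hρ : s - 8 ≤ ρ) {v : V} (hv : v ≠ x) : s * |f v| ≤ 260 := by
  have h1 := h.sq_mul_abs_le hG v
  have h2 := h.mul_sum_abs_le hG
  have h3 := hx.realDegree_le hG hv
  have hs := hx.large
  have h4 : realDegree G v * |f v| ≤ 41 * s :=
    (mul_le_of_le_one_right (neighborSum_nonneg (fun _ => zero_le_one) v) (h.abs_le_one v)).trans h3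
  rw [← hx.sq_eq] at h2
  have hρ2 : s / 2 ≤ ρ := by linarith
  have h5 : ∑ w, |f w| ≤ 12 * s := by
    refine le_of_mul_le_mul_left ?_ h.pos
    nlinarith
  have h6 : (s / 2) ^ 2 * |f v| ≤ ρ ^ 2 * |f v| :=
    mul_le_mul_of_nonneg_right (pow_le_pow_left₀ (by linarith) hρ2 2) (abs_nonneg _)
  refine le_of_mul_le_mul_left (a := s) ?_ (by linarith)
  nlinarith

/-- A vertex not adjacent to the hub gains a further factor 1/s, because it does not see the large
entry at x. Applying the eigenvalue inequality twice to |f| restricted to such vertices leaves only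
bounded terms. -/
theorem sq_mul_abs_le (hx : IsHub G x s) (hG : IsSparse G) (h : IsNormalizedEigenvector G ε ρ x f)
    (hρ : s - 8 ≤ ρ) {v : V} (hvx : v ≠ x) (hv : ¬ G.Adj x v) : s ^ 2 * |f v| ≤ 220000 := by
  classical
  have hs := hx.large
  have hs0 : 0 < s := by linarith
  have hρ2 : s / 2 ≤ ρ := by linarith
  have hρs : ρ ≤ 2 * s := by linarith [h.le_add_six hG hs0 hx.sq_eq]
  set g : V → ℝ := fun w => nonneighbor G x w * |f w| with hgdef
  have hg0 : ∀ w, 0 ≤ g w := fun w => mul_nonneg (nonneighbor_nonneg x w) (abs_nonneg _)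
  have hsmall : ∀ w, w ≠ x → |f w| ≤ 260 / s := fun w hw => by
    rw [le_div_iff₀ hs0, mul_comm]; exact hx.mul_abs_le hG h hρ hw
  have hgs : ∀ w, g w ≤ 260 / s * nonneighbor G x w := by
    intro w
    by_cases hw : w = x ∨ G.Adj x w
    · simp [hgdef, nonneighbor_of_mem hw]
    · have := hsmall w (fun h => hw (Or.inl h))
      simpa [hgdef, nonneighbor_of_notMem hw] using this
  -- At most two neighbours of such a u are adjacent to x, each with entry at most 260/s; the
  -- remaining ones are counted by `g`.
  have key : ∀ u, ρ * g u ≤ 520 / s + neighborSum G g u := by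
    intro u
    have hn := neighborSum_nonneg (G := G) hg0 u
    by_cases hu : u = x ∨ G.Adj x u
    · have : g u = 0 := by simp [hgdef, nonneighbor_of_mem hu]
      rw [this, mul_zero]
      positivity
    · have hgu : g u = |f u| := by simp [hgdef, nonneighbor_of_notMem hu]
      push Not at hu
      rw [hgu]
      refine (h.mul_abs_le u).trans ?_
      have h1 : neighborSum G (fun w => |f w|) u ≤
          neighborSum G (fun w => (|f w| - g w) + g w) u := by
        simp
      rw [neighborSum_add] at h1
      have h2 : neighborSum G (fun w => |f w| - g w) u ≤ 2 * (260 / s) := by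
        have hle : neighborSum G (fun w => |f w| - g w) u ≤
            neighborSum G (fun w => if w = x then 0 else |f w| - g w) u := by
          refine neighborSum_mono fun w hw => ?_
          have : w ≠ x := by rintro rfl; exact hu.2 hw.symm
          rw [if_neg this]
        refine hle.trans (hG.neighborSum_common_le hu.1 (by positivity) (fun w hw => ?_)
          (fun w hw => ?_))
        · rw [if_neg hw.ne']
          linarith [hsmall w hw.ne', hg0 w]
        · split_ifs with hwx
          · exact le_rfl
          · have : ¬ (w = x ∨ G.Adj x w) := by tauto
            simp [hgdef, nonneighbor_of_notMem this]
      have h3 : 2 * (260 / s) = 520 / s := by ring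
      linarith
  have hgv : g v = |f v| := by
    have : ¬ (v = x ∨ G.Adj x v) := by tauto
    simp [hgdef, nonneighbor_of_notMem this]
  have hdv := hx.realDegree_le hG hvx
  have h1 : ρ * neighborSum G g v ≤ 520 / s * realDegree G v +
      (realDegree G v * g v + 2 * ∑ w, g w) := by
    rw [← neighborSum_const_mul]
    refine (neighborSum_mono fun w _ => key w).trans ?_
    rw [neighborSum_add, neighborSum_const]
    linarith [hG.neighborSum_neighborSum_le hg0 v]
  have h2 : ∑ w, g w ≤ 260 / s * (40 * s) := by
    refine (Finset.sum_le_sum fun w _ => hgs w).trans ?_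
    rw [← Finset.mul_sum]
    exact mul_le_mul_of_nonneg_left hx.sum_nonneighbor_le (by positivity)
  have h3 : 520 / s * realDegree G v ≤ 520 / s * (41 * s) :=
    mul_le_mul_of_nonneg_left hdv (by positivity)
  have h4 : realDegree G v * g v ≤ 41 * s * (260 / s) := by
    rw [hgv]
    exact mul_le_mul hdv (hsmall v hvx) (abs_nonneg _) (by positivity)
  have h5 : ρ ^ 2 * |f v| ≤ ρ * (520 / s) + ρ * neighborSum G g v := by
    have := mul_le_mul_of_nonneg_left (key v) h.pos.le
    rw [hgv] at this
    linarith
  have h6 : ρ * (520 / s) ≤ 2 * s * (520 / s) := mul_le_mul_of_nonneg_right hρs (by positivity)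
  have h7 : (s / 2) ^ 2 * |f v| ≤ ρ ^ 2 * |f v| :=
    mul_le_mul_of_nonneg_right (pow_le_pow_left₀ (by linarith) hρ2 2) (abs_nonneg _)
  have e1 : 260 / s * (40 * s) = 10400 := by field_simp; norm_num
  have e2 : 520 / s * (41 * s) = 21320 := by field_simp; norm_num
  have e3 : 41 * s * (260 / s) = 10660 := by field_simp; norm_num
  have e4 : 2 * s * (520 / s) = 1040 := by field_simp; norm_num
  rw [e1] at h2
  rw [e2] at h3
  rw [e3] at h4
  rw [e4] at h6
  nlinarith

end IsHub

end OuterplanarSpread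

namespace OuterplanarSpread

open Set

/-! ### Joining a hub to all vertices -/

section HubClosure

variable {V : Type*} {G : SimpleGraph V}

/-- The graph in which `x` is joined to all vertices, and the other edges are the edges of `G`
between neighbours of `x`. -/
def hubClosure (G : SimpleGraph V) (x : V) : SimpleGraph V where
  Adj u v := u ≠ v ∧ (u = x ∨ v = x ∨ (G.Adj u v ∧ G.Adj x u ∧ G.Adj x v))
  symm := ⟨fun u v ⟨h, h'⟩ => ⟨h.symm, by rw [G.adj_comm v u]; tauto⟩⟩
  loopless := ⟨fun _ h => h.1 rfl⟩

/-- The edges of `G` between neighbours of `x`. -/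
def linkGraph (G : SimpleGraph V) (x : V) : SimpleGraph V where
  Adj u v := G.Adj u v ∧ G.Adj x u ∧ G.Adj x v
  symm := ⟨fun _ _ ⟨h, h', h''⟩ => ⟨h.symm, h'', h'⟩⟩
  loopless := ⟨fun _ h => h.1.ne rfl⟩

/-- The link of x is acyclic, and three neighbours of u inside it would be three common neighbours
of u and x. -/
theorem IsOuterplanar.exists_line_order_link [Fintype V] (h : IsOuterplanar G) (x : V) :
    ∃ r : V → ℤ, Function.Injective r ∧ ∀ u v, (linkGraph G x).Adj u v → |r u - r v| = 1 := by
  classical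
  obtain ⟨D⟩ := h.nonempty_outerDrawing
  refine exists_line_order (D.isAcyclic_of_adj_common (x := x) (fun _ _ h => h.1)
    fun _ _ h => h.2.1) ?_
  intro u a b c ha hb hc
  by_contra! hne
  have := D.card_common_neighbors_le_two ha.2.1.ne
  refine absurd this (not_le.2 (Finset.two_lt_card_iff.2 ⟨a, b, c, ?_, ?_, ?_, hne.1, hne.2.1,
    hne.2.2⟩))
  · simp [ha.1, ha.2.2]
  · simp [hb.1, hb.2.2]
  · simp [hc.1, hc.2.2]

theorem IsOuterplanar.hubClosure [Fintype V] (h : IsOuterplanar G) (x : V) :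
    IsOuterplanar (hubClosure G x) := by
  obtain ⟨r, hr, hadj⟩ := h.exists_line_order_link x
  refine isOuterplanar_of_fan _ (x := x) (r := r) (fun u v _ _ huv => hr huv) ?_
  rintro u v ⟨-, h | h | h⟩
  · exact Or.inl h
  · exact Or.inr (Or.inl h)
  · exact Or.inr (Or.inr (hadj u v h))

end HubClosure

variable {V : Type*} [Fintype V] {G : SimpleGraph V} {x : V} {s ε ρ : ℝ} {f : V → ℝ}

theorem adjForm_sub_self (g : V → ℝ) :
    adjForm G (fun v => f v - g v) (fun v => f v - g v) =
      adjForm G f f - 2 * adjForm G g f + adjForm G g g := by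
  have h : ∀ v, neighborSum G (fun v => f v - g v) v = neighborSum G f v - neighborSum G g v := by
    intro v
    have := neighborSum_add (G := G) f (fun w => (-1) * g w) v
    rw [neighborSum_const_mul] at this
    have e : (fun w => f w - g w) = fun w => f w + (-1) * g w := by ext; ring
    rw [e, this]; ring
  have h2 := adjForm_comm G f g
  simp only [adjForm, h, sub_mul, mul_sub, Finset.sum_sub_distrib] at h2 ⊢
  linarith

/-- Former non-neighbours of x now have x as their only neighbour, so each contributes 2c; among x
and its old neighbours nothing has changed. -/
theorem adjForm_hubClosure (hfx : f x = 1) (c : ℝ) :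
    adjForm (hubClosure G x) (fun v => f v - nonneighbor G x v * f v + c * nonneighbor G x v)
      (fun v => f v - nonneighbor G x v * f v + c * nonneighbor G x v) =
    adjForm G (fun v => f v - nonneighbor G x v * f v) (fun v => f v - nonneighbor G x v * f v) +
      2 * c * ∑ v, nonneighbor G x v := by
  classical
  have h1 : 2 * c * ∑ v, nonneighbor G x v =
      ∑ u, ∑ v, ((if u = x then c * nonneighbor G x v else 0) +
        (if v = x then c * nonneighbor G x u else 0)) := by
    simp only [Finset.sum_add_distrib]
    rw [Finset.sum_comm]
    simp only [Finset.sum_ite_eq', Finset.mem_univ, if_true, ← Finset.mul_sum]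
    ring
  rw [h1]
  simp only [adjForm, neighborSum, Finset.mul_sum, ← Finset.sum_add_distrib]
  refine Finset.sum_congr rfl fun u _ => Finset.sum_congr rfl fun v _ => ?_
  have hnx : nonneighbor G x x = 0 := nonneighbor_of_mem (Or.inl rfl)
  by_cases hu : u = x
  · subst hu
    by_cases hv : v = u
    · subst hv
      simp [hnx, hubClosure]
    · by_cases hv' : G.Adj u v
      · simp [hnx, hubClosure, hv, Ne.symm hv, hv', nonneighbor_of_mem (Or.inr hv')]
      · have : nonneighbor G u v = 1 := nonneighbor_of_notMem (by tauto)
        simp [hnx, hubClosure, hv, Ne.symm hv, hv', this, hfx]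
  · by_cases hv : v = x
    · subst hv
      by_cases hu' : G.Adj v u
      · simp [hnx, hubClosure, hu, hu', hu'.symm, nonneighbor_of_mem (Or.inr hu')]
      · have : nonneighbor G v u = 1 := nonneighbor_of_notMem (by tauto)
        have hu'' : ¬ G.Adj u v := fun h => hu' h.symm
        simp [hnx, hubClosure, hu, hu'', this, hfx]
    · by_cases hu' : G.Adj x u <;> by_cases hv' : G.Adj x v
      · have : (hubClosure G x).Adj u v ↔ G.Adj u v := by
          simp only [hubClosure, hu, hv, hu', hv', and_true, false_or]
          exact ⟨fun h => h.2, fun h => ⟨h.ne, h⟩⟩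
        simp [this, hu, hv, nonneighbor_of_mem (Or.inr hu'), nonneighbor_of_mem (Or.inr hv')]
      · have : nonneighbor G x v = 1 := nonneighbor_of_notMem (by tauto)
        simp [hubClosure, hu, hv, hv', this]
      · have : nonneighbor G x u = 1 := nonneighbor_of_notMem (by tauto)
        simp [hubClosure, hu, hv, hu', this]
      · have : nonneighbor G x u = 1 := nonneighbor_of_notMem (by tauto)
        simp [hubClosure, hu, hv, hu', this]

theorem abs_adjForm_self_le {g : V → ℝ} {d : ℝ} (h : ∀ v, g v ≠ 0 → realDegree G v ≤ d) :
    |adjForm G g g| ≤ d * ∑ v, g v ^ 2 := by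
  classical
  have h1 : |adjForm G g g| ≤ ∑ v, ∑ w, if G.Adj v w then (g v ^ 2 / 2 + g w ^ 2 / 2) else 0 := by
    refine (Finset.abs_sum_le_sum_abs _ _).trans (Finset.sum_le_sum fun v _ => ?_)
    rw [neighborSum, Finset.mul_sum]
    refine (Finset.abs_sum_le_sum_abs _ _).trans (Finset.sum_le_sum fun w _ => ?_)
    split_ifs
    · rw [abs_le]
      constructor <;> nlinarith [sq_nonneg (g v - g w), sq_nonneg (g v + g w)]
    · simp
  have h2 : ∑ v, ∑ w, (if G.Adj v w then (g v ^ 2 / 2 + g w ^ 2 / 2) else 0) =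
      ∑ v, g v ^ 2 * realDegree G v := by
    have e : ∀ v, ∑ w, (if G.Adj v w then (g v ^ 2 / 2 + g w ^ 2 / 2) else 0) =
        g v ^ 2 / 2 * realDegree G v + neighborSum G (fun w => g w ^ 2 / 2) v := by
      intro v
      rw [← neighborSum_const, ← neighborSum_add]; rfl
    simp only [e]
    rw [Finset.sum_add_distrib, sum_neighborSum, ← Finset.sum_add_distrib]
    exact Finset.sum_congr rfl fun v _ => by ring
  rw [h2] at h1
  refine h1.trans ?_
  rw [Finset.mul_sum]
  refine Finset.sum_le_sum fun v _ => ?_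
  by_cases hv : g v = 0
  · simp [hv]
  · rw [mul_comm]
    exact mul_le_mul_of_nonneg_right (h v hv) (sq_nonneg _)

/-- If the hub `x` is not adjacent to all vertices, then joining it to all vertices increases
the extreme eigenvalue. -/
theorem IsHub.lt_of_isTopEigenvalue_hubClosure (hx : IsHub G x s) (hG : IsSparse G)
    (h : IsNormalizedEigenvector G ε ρ x f) (hρ : s - 8 ≤ ρ) {ρ' : ℝ}
    (hρ' : IsTopEigenvalue (hubClosure G x) ε ρ') (hne : ∃ v, v ≠ x ∧ ¬ G.Adj x v) : ρ < ρ' := by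
  by_contra! hle
  have hs := hx.large
  have hs0 : 0 < s := by linarith
  have hρs : ρ ≤ 2 * s := by linarith [h.le_add_six hG hs0 hx.sq_eq]
  set χ := nonneighbor G x with hχ
  set g : V → ℝ := fun v => χ v * f v with hg
  set k := ∑ v, χ v with hk
  -- New value on the non-neighbours, up to sign; it maximizes 2δ - 2sδ², the gain per vertex minus
  -- the cost of the norm when ρ ≤ 2s.
  set δ : ℝ := 1 / (2 * s) with hδ
  have hδs : δ * s = 1 / 2 := by rw [hδ]; field_simp
  have hδ0 : 0 < δ := by positivity
  have hk0 : 0 < k := by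
    obtain ⟨v, hv, hv'⟩ := hne
    refine Finset.sum_pos' (fun w _ => nonneighbor_nonneg x w) ⟨v, Finset.mem_univ v, ?_⟩
    rw [hχ, nonneighbor_of_notMem (by tauto)]; norm_num
  have hform := hρ'.form_le (fun v => f v - g v + ε * δ * χ v)
  have e1 := adjForm_hubClosure (G := G) h.apply_eq_one (ε * δ)
  have e2 := adjForm_sub_self (G := G) (f := f) g
  have e3 : ε * adjForm G f f = ρ * ∑ v, f v ^ 2 := by
    rw [adjForm, Finset.mul_sum, Finset.mul_sum]
    refine Finset.sum_congr rfl fun v _ => ?_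
    linear_combination f v * h.eigen v
  have e4 : ε * adjForm G g f = ρ * ∑ v, g v ^ 2 := by
    rw [adjForm, Finset.mul_sum, Finset.mul_sum]
    refine Finset.sum_congr rfl fun v _ => ?_
    have := nonneighbor_mul_self (G := G) x v
    rw [← hχ] at this
    simp only [hg]
    linear_combination χ v * f v * h.eigen v - ρ * f v ^ 2 * this
  have e5 : ∑ v, (f v - g v + ε * δ * χ v) ^ 2 = ∑ v, f v ^ 2 - ∑ v, g v ^ 2 + k * δ ^ 2 := by
    rw [hk, Finset.sum_mul, ← Finset.sum_sub_distrib, ← Finset.sum_add_distrib]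
    refine Finset.sum_congr rfl fun v _ => ?_
    have h1 := nonneighbor_mul_self (G := G) x v
    rw [← hχ] at h1
    have h2 := h.eps_mul_eps
    simp only [hg]
    linear_combination (2 * f v ^ 2 - 2 * ε * δ * f v + ε ^ 2 * δ ^ 2) * h1 + δ ^ 2 * χ v * h2
  have b1 : |adjForm G g g| ≤ 41 * s * ∑ v, g v ^ 2 := by
    refine abs_adjForm_self_le fun v hv => hx.realDegree_le hG ?_
    rintro rfl
    exact hv (by simp [hg, hχ, nonneighbor_of_mem (Or.inl rfl : v = v ∨ G.Adj v v)])
  have b2 : -(41 * s * ∑ v, g v ^ 2) ≤ ε * adjForm G g g := by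
    have : |ε * adjForm G g g| ≤ 41 * s * ∑ v, g v ^ 2 := by rwa [abs_mul, h.abs_eps, one_mul]
    exact (abs_le.1 this).1
  have b3 : s ^ 4 * ∑ v, g v ^ 2 ≤ 220000 ^ 2 * k := by
    rw [hk, Finset.mul_sum, Finset.mul_sum]
    refine Finset.sum_le_sum fun v _ => ?_
    by_cases hv : v = x ∨ G.Adj x v
    · simp [hg, hχ, nonneighbor_of_mem hv]
    · have h1 : χ v = 1 := nonneighbor_of_notMem hv
      have h2 := hx.sq_mul_abs_le hG h hρ (fun e => hv (Or.inl e)) (fun e => hv (Or.inr e))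
      have h3 : (s ^ 2 * |f v|) ^ 2 ≤ 220000 ^ 2 := pow_le_pow_left₀ (by positivity) h2 2
      rw [mul_pow, sq_abs] at h3
      simp only [hg, h1]
      linarith
  have hε2 := h.eps_mul_eps
  have e6 : ε * adjForm (hubClosure G x) (fun v => f v - g v + ε * δ * χ v)
      (fun v => f v - g v + ε * δ * χ v) =
      ρ * ∑ v, f v ^ 2 - 2 * (ρ * ∑ v, g v ^ 2) + ε * adjForm G g g + 2 * δ * k := by
    have : adjForm (hubClosure G x) (fun v => f v - g v + ε * δ * χ v)
      (fun v => f v - g v + ε * δ * χ v) = adjForm G f f - 2 * adjForm G g f + adjForm G g g +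
        2 * (ε * δ) * k := by rw [← e2]; exact e1
    rw [this]
    linear_combination e3 - 2 * e4 + 2 * δ * k * hε2
  have hS : 0 ≤ ∑ v, (f v - g v + ε * δ * χ v) ^ 2 := Finset.sum_nonneg fun v _ => sq_nonneg _
  have b4 := mul_le_mul_of_nonneg_right hle hS
  set Γ := ∑ v, g v ^ 2 with hΓ
  have hΓ0 : 0 ≤ Γ := Finset.sum_nonneg fun v _ => sq_nonneg _
  rw [e6] at hform
  have b5 : 2 * δ * k ≤ ρ * Γ + 41 * s * Γ + ρ * (k * δ ^ 2) := by
    rw [e5] at b4 hform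
    linarith
  have b6 : ρ * Γ ≤ 2 * s * Γ := mul_le_mul_of_nonneg_right hρs hΓ0
  have b7 : ρ * (k * δ ^ 2) ≤ 2 * s * (k * δ ^ 2) :=
    mul_le_mul_of_nonneg_right hρs (by positivity)
  have b8 : 2 * s * (k * δ ^ 2) = δ * k := by
    linear_combination 2 * k * δ * hδs
  have b9 : δ * k ≤ 43 * s * Γ := by linarith
  have b10 : k / 2 ≤ 43 * s ^ 2 * Γ := by
    have := mul_le_mul_of_nonneg_left b9 hs0.le
    have e : s * (δ * k) = k / 2 := by linear_combination k * hδs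
    rw [e] at this
    linarith
  have b11 : s ^ 2 * (k / 2) ≤ 43 * (220000 ^ 2 * k) := by
    have := mul_le_mul_of_nonneg_left b10 (sq_nonneg s)
    nlinarith
  -- The gain is of order k/s and the loss of order k/s³; the bound 10⁷ on s makes the gain prevail.
  have b12 : s ^ 2 ≤ 86 * 220000 ^ 2 := by
    refine le_of_mul_le_mul_right ?_ hk0
    linarith
  have b13 : (10 ^ 7 : ℝ) ^ 2 ≤ s ^ 2 := pow_le_pow_left₀ (by norm_num) hs 2
  norm_num at b12 b13
  linarith

open Classical in
/-- The indicator function of the complement of `x`. -/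
noncomputable def offHub {W : Type*} (x : W) (v : W) : ℝ := if v = x then 0 else 1

/-- Expansion of the square of the extreme eigenvalue for a hub that is joined to all vertices. -/
theorem IsHub.exists_sq_eq (hx : IsHub G x s) (hG : IsSparse G)
    (h : IsNormalizedEigenvector G ε ρ x f) (hρ : s - 8 ≤ ρ) (hdom : ∀ v, v ≠ x → G.Adj x v) :
    ∃ T : ℝ, ρ ^ 2 = Fintype.card V - 1 + T ∧
      |ρ * T - ε * adjForm G (offHub x) (offHub x)| ≤
        520 / s * adjForm G (offHub x) (offHub x) := by
  classical
  have hs := hx.large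
  have hs0 : 0 < s := by linarith
  set e : V → ℝ := offHub x with he
  have hex : e x = 0 := if_pos rfl
  have hev : ∀ v, v ≠ x → e v = 1 := fun v hv => if_neg hv
  have he0 : ∀ v, 0 ≤ e v := fun v => by rw [he, offHub]; split_ifs <;> norm_num
  have hne0 : ∀ v, 0 ≤ neighborSum G e v := neighborSum_nonneg he0
  set p : V → ℝ := fun v => e v * f v with hp
  have hsplit : ∀ v, v ≠ x → neighborSum G f v = 1 + neighborSum G p v := by
    intro v hv
    have h1 : neighborSum G f v = neighborSum G (fun w => (if w = x then 1 else 0) + p w) v := by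
      congr 1
      ext w
      by_cases hw : w = x
      · subst hw; simp [hp, hex, h.apply_eq_one]
      · simp [hp, hev w hw, hw]
    rw [h1, neighborSum_add]
    congr 1
    rw [neighborSum]
    have : ∀ w, (if G.Adj v w then (if w = x then (1 : ℝ) else 0) else 0) =
        if w = x then 1 else 0 := by
      intro w
      by_cases hw : w = x
      · subst hw; simp [(hdom v hv).symm]
      · simp [hw]
    simp [this]
  have hρe : ∀ v, ρ * p v = ε * (e v * (1 + neighborSum G p v)) := by
    intro v
    by_cases hv : v = x
    · subst hv; simp [hp, hex]
    · have := h.eigen v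
      rw [hsplit v hv] at this
      simp only [hp, hev v hv, one_mul]
      exact this.symm
  have hρx : ρ = ε * ∑ v, p v := by
    have h1 := h.eigen x
    rw [h.apply_eq_one, mul_one] at h1
    rw [← h1, neighborSum]
    congr 1
    refine Finset.sum_congr rfl fun v _ => ?_
    by_cases hv : v = x
    · subst hv; simp [hp, hex]
    · simp [hp, hev v hv, hdom v hv]
  have hcard : ∑ v, e v = Fintype.card V - 1 := by
    have : ∀ v, e v = 1 - if v = x then (1 : ℝ) else 0 := by
      intro v; rw [he, offHub]; split_ifs <;> norm_num
    simp only [this, Finset.sum_sub_distrib]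
    simp
  -- With A the adjacency matrix, T = ⟨e, Ap⟩. Off the hub ρp = ε(e + Ap), and at the hub ρ = ε Σ p.
  -- Substituting once gives ρ² = n - 1 + T; substituting in T = ⟨p, Ae⟩ gives ρT = ε⟨e, Ae⟩ plus an
  -- error, in which |Ap| ≤ 2 · 260/s off the hub.
  refine ⟨∑ v, e v * neighborSum G p v, ?_, ?_⟩
  · have h1 : ρ ^ 2 = ε * ∑ v, ρ * p v := by
      rw [← Finset.mul_sum]
      linear_combination ρ * hρx
    rw [h1]
    simp only [hρe]
    rw [← Finset.mul_sum, ← mul_assoc, h.eps_mul_eps, one_mul, ← hcard, ← Finset.sum_add_distrib]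
    exact Finset.sum_congr rfl fun v _ => by ring
  · have h1 : ∑ v, e v * neighborSum G p v = ∑ v, p v * neighborSum G e v := adjForm_comm G e p
    have h2 : ρ * ∑ v, e v * neighborSum G p v - ε * adjForm G e e =
        ε * ∑ v, e v * neighborSum G e v * neighborSum G p v := by
      rw [h1, adjForm, Finset.mul_sum, Finset.mul_sum, Finset.mul_sum, ← Finset.sum_sub_distrib]
      refine Finset.sum_congr rfl fun v _ => ?_
      linear_combination neighborSum G e v * hρe v
    rw [h2, abs_mul, h.abs_eps, one_mul, adjForm, Finset.mul_sum]
    refine (Finset.abs_sum_le_sum_abs _ _).trans (Finset.sum_le_sum fun v _ => ?_)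
    rw [abs_mul, abs_of_nonneg (mul_nonneg (he0 v) (hne0 v)), mul_comm]
    refine (eq_or_ne v x).elim (fun hv => by rw [hv, hex]; simp) fun hv => ?_
    refine mul_le_mul_of_nonneg_right ?_ (mul_nonneg (he0 v) (hne0 v))
    refine (abs_neighborSum_le p v).trans ?_
    have hpw : ∀ w, w ≠ x → |p w| ≤ 260 / s := by
      intro w hw
      rw [le_div_iff₀ hs0, mul_comm]
      simpa [hp, hev w hw] using hx.mul_abs_le hG h hρ hw
    have := hG.neighborSum_common_le hv (f := fun w => |p w|) (c := 260 / s) (by positivity)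
      (fun w hw => hpw w hw.ne') (fun w hw => by
        have : w = x := by by_contra hne; exact hw (hdom w hne)
        simp [this, hp, hex])
    refine this.trans (le_of_eq ?_)
    ring

end OuterplanarSpread

namespace OuterplanarSpread

open Set

/-! ### The fan with one long path -/

/-- The join of a vertex with a path on `k` vertices. -/
def fanGraph (k : ℕ) : SimpleGraph (Fin (k + 1)) where
  Adj u v := u ≠ v ∧ (u = 0 ∨ v = 0 ∨ u.val + 1 = v.val ∨ v.val + 1 = u.val)
  symm := ⟨fun u v ⟨h, h'⟩ => ⟨h.symm, by tauto⟩⟩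
  loopless := ⟨fun _ h => h.1 rfl⟩

theorem isOuterplanar_fanGraph (k : ℕ) : IsOuterplanar (fanGraph k) := by
  refine isOuterplanar_of_fan _ (x := 0) (r := fun v => (v.val : ℤ))
    (fun u v _ _ h => Fin.ext (by exact_mod_cast h)) ?_
  rintro u v ⟨-, h | h | h | h⟩
  · exact Or.inl h
  · exact Or.inr (Or.inl h)
  · refine Or.inr (Or.inr ?_)
    rw [← h, abs_eq zero_le_one]
    right; push_cast; ring
  · refine Or.inr (Or.inr ?_)
    rw [← h, abs_eq zero_le_one]
    left; push_cast; ring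

theorem sum_sum_consecutive (m : ℕ) :
    ∑ i : Fin (m + 1), ∑ j : Fin (m + 1), (if i.val + 1 = j.val then (1 : ℝ) else 0) = m := by
  rw [Finset.sum_comm, Fin.sum_univ_succ]
  have h : ∀ l : Fin m, ∑ i : Fin (m + 1), (if i.val + 1 = l.succ.val then (1 : ℝ) else 0) = 1 := by
    intro l
    rw [Finset.sum_eq_single l.castSucc]
    · simp
    · intro i _ hi
      refine if_neg fun h => hi (Fin.ext ?_)
      simpa using h
    · simp
  rw [Finset.sum_congr rfl fun l _ => h l]
  simp

/-- The test vector with entry `1` at the hub of a fan and `c` elsewhere. -/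
noncomputable def fanVector (k : ℕ) (c : ℝ) (v : Fin (k + 1)) : ℝ := if v = 0 then 1 else c

theorem sum_fanVector_sq (k : ℕ) (c : ℝ) : ∑ v, fanVector k c v ^ 2 = 1 + k * c ^ 2 := by
  rw [Fin.sum_univ_succ]
  simp [fanVector, Fin.succ_ne_zero]

theorem adjForm_fanVector (m : ℕ) (c : ℝ) :
    adjForm (fanGraph (m + 1)) (fanVector (m + 1) c) (fanVector (m + 1) c) =
      2 * c * (m + 1) + 2 * c ^ 2 * m := by
  have h0 : neighborSum (fanGraph (m + 1)) (fanVector (m + 1) c) 0 = (m + 1) * c := by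
    rw [neighborSum, Fin.sum_univ_succ]
    simp [fanVector, Fin.succ_ne_zero, fanGraph, (Fin.succ_ne_zero _).symm]
  have hs : ∀ i : Fin (m + 1), neighborSum (fanGraph (m + 1)) (fanVector (m + 1) c) i.succ =
      1 + c * (∑ j : Fin (m + 1), (if i.val + 1 = j.val then (1 : ℝ) else 0) +
        ∑ j : Fin (m + 1), (if j.val + 1 = i.val then (1 : ℝ) else 0)) := by
    intro i
    rw [neighborSum, Fin.sum_univ_succ]
    congr 1
    · simp [fanVector, fanGraph, Fin.succ_ne_zero]
    · rw [← Finset.sum_add_distrib, Finset.mul_sum]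
      refine Finset.sum_congr rfl fun j _ => ?_
      have hadj : (fanGraph (m + 1)).Adj i.succ j.succ ↔
          (i.val + 1 = j.val ∨ j.val + 1 = i.val) := by
        simp only [fanGraph, Fin.succ_ne_zero, false_or, ne_eq, Fin.succ_inj, Fin.val_succ]
        rw [Fin.ext_iff]
        omega
      simp only [hadj, fanVector, Fin.succ_ne_zero, if_false]
      by_cases h1 : i.val + 1 = j.val
      · have h2 : ¬ j.val + 1 = i.val := by omega
        simp [h1, h2]
      · simp [h1]
  rw [adjForm, Fin.sum_univ_succ, h0]
  simp only [hs, fanVector, Fin.succ_ne_zero, if_true, if_false]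
  rw [← Finset.mul_sum, Finset.sum_add_distrib, ← Finset.mul_sum, Finset.sum_add_distrib,
    sum_sum_consecutive, Finset.sum_comm (f := fun i j : Fin (m + 1) =>
      if j.val + 1 = i.val then (1 : ℝ) else 0), sum_sum_consecutive]
  simp
  ring

/-- A star has spread only 2σ. The path contributes +1 to one eigenvalue and -1 to the other, which
cancel; the second-order terms are the gain, and each eigenvalue is credited with 1/(4σ). -/
theorem le_spread_fanGraph {k : ℕ} {σ : ℝ} (hσ : 10 ≤ σ) (hk : σ ^ 2 = k) :
    2 * σ + 1 / (2 * σ) ≤ spread (fanGraph k) := by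
  obtain ⟨ρ₁, ρ₂, hS, h₁, h₂⟩ := exists_topEigenvalues (fanGraph k)
  have hσ0 : 0 < σ := by linarith
  obtain ⟨m, rfl⟩ : ∃ m, k = m + 1 := by
    refine Nat.exists_eq_succ_of_ne_zero ?_
    rintro rfl
    have : 0 < σ ^ 2 := by positivity
    simp_all
  have hm : (m : ℝ) = σ ^ 2 - 1 := by rw [hk]; push_cast; ring
  have key : ∀ (ε ρ c b : ℝ), IsTopEigenvalue (fanGraph (m + 1)) ε ρ →
      0 ≤ ε * (2 * c * σ ^ 2 + 2 * c ^ 2 * (σ ^ 2 - 1)) - b * (1 + σ ^ 2 * c ^ 2) → b ≤ ρ := by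
    intro ε ρ c b h hb
    have h1 := h.form_le (fanVector (m + 1) c)
    rw [adjForm_fanVector, sum_fanVector_sq, ← hk, hm] at h1
    by_contra! hlt
    have h2 : 0 < 1 + σ ^ 2 * c ^ 2 := by positivity
    have h3 := mul_lt_mul_of_pos_right hlt h2
    linarith
  have e₁ : σ + 1 + 1 / (4 * σ) ≤ ρ₁ := by
    -- The eigenvalue equation at the hub reads kc = ρ; the choice of c inserts the first-order
    -- value σ + 1 of ρ.
    refine key 1 ρ₁ ((σ + 1) / σ ^ 2) _ h₁ ?_
    have : 1 * (2 * ((σ + 1) / σ ^ 2) * σ ^ 2 + 2 * ((σ + 1) / σ ^ 2) ^ 2 * (σ ^ 2 - 1)) -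
        (σ + 1 + 1 / (4 * σ)) * (1 + σ ^ 2 * ((σ + 1) / σ ^ 2) ^ 2) =
        (2 * σ ^ 3 - 6 * σ ^ 2 - 17 * σ - 8) / (4 * σ ^ 4) := by
      field_simp
      ring
    rw [this]
    refine div_nonneg ?_ (by positivity)
    nlinarith [mul_nonneg (sub_nonneg.2 hσ) (sub_nonneg.2 hσ), pow_pos hσ0 2,
      mul_nonneg (sub_nonneg.2 hσ) (sq_nonneg σ)]
  have e₂ : σ - 1 + 1 / (4 * σ) ≤ ρ₂ := by
    refine key (-1) ρ₂ (-((σ - 1) / σ ^ 2)) _ h₂ ?_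
    have : -1 * (2 * -((σ - 1) / σ ^ 2) * σ ^ 2 + 2 * (-((σ - 1) / σ ^ 2)) ^ 2 * (σ ^ 2 - 1)) -
        (σ - 1 + 1 / (4 * σ)) * (1 + σ ^ 2 * (-((σ - 1) / σ ^ 2)) ^ 2) =
        (2 * σ ^ 3 + 6 * σ ^ 2 - 17 * σ + 8) / (4 * σ ^ 4) := by
      field_simp
      ring
    rw [this]
    refine div_nonneg ?_ (by positivity)
    nlinarith [mul_nonneg (sub_nonneg.2 hσ) (sub_nonneg.2 hσ), pow_pos hσ0 2, pow_pos hσ0 3]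
  have : 1 / (2 * σ) = 1 / (4 * σ) + 1 / (4 * σ) := by field_simp; norm_num
  rw [hS, this]
  linarith

/-! ### Extremal graphs -/

theorem IsTopEigenvalue.exists_isNormalizedEigenvector {V : Type*} [Fintype V]
    {G : SimpleGraph V} {ε ρ : ℝ} (h : IsTopEigenvalue G ε ρ) (hε : ε = 1 ∨ ε = -1)
    (hρ : 0 < ρ) : ∃ x f, IsNormalizedEigenvector G ε ρ x f := by
  obtain ⟨x, f, h1, h2, h3⟩ := h.exists_normalized
  exact ⟨x, f, hε, hρ, h1, h2, h3⟩

theorem IsTopEigenvalue.le_add_six {V : Type*} [Fintype V] {G : SimpleGraph V} {ε ρ s : ℝ}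
    (h : IsTopEigenvalue G ε ρ) (hε : ε = 1 ∨ ε = -1) (hG : IsSparse G) (hs : 0 < s)
    (hsn : s ^ 2 = Fintype.card V) : ρ ≤ s + 6 := by
  by_cases hρ : 0 < ρ
  · obtain ⟨x, f, hf⟩ := h.exists_isNormalizedEigenvector hε hρ
    exact hf.le_add_six hG hs hsn
  · linarith

theorem adjForm_offHub_nonneg {V : Type*} [Fintype V] (G : SimpleGraph V) (x : V) :
    0 ≤ adjForm G (offHub x) (offHub x) := by
  have h : ∀ v, 0 ≤ offHub x v := fun v => by unfold offHub; split_ifs <;> norm_num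
  exact Finset.sum_nonneg fun v _ => mul_nonneg (h v) (neighborSum_nonneg h v)

/-- Adding ρ₁T₁ ≤ M + 520M/s and ρ₂T₂ ≤ -M + 520M/s cancels the main terms. As T₁ + T₂ ≥ 1 and T₁ ≥
0, replacing ρ₁ by the smaller ρ₂ leaves ρ₂ ≤ 1040M/s. -/
theorem IsHub.card_le_adjForm {V : Type*} [Fintype V] {G : SimpleGraph V} {x : V} {s ρ₁ ρ₂ : ℝ}
    {f₁ f₂ : V → ℝ} (hx : IsHub G x s) (hG : IsSparse G)
    (h₁ : IsNormalizedEigenvector G 1 ρ₁ x f₁) (h₂ : IsNormalizedEigenvector G (-1) ρ₂ x f₂)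
    (hρ₁ : s - 8 ≤ ρ₁) (hρ₂ : s - 8 ≤ ρ₂) (hdom : ∀ v, v ≠ x → G.Adj x v)
    (hS : 4 * ((Fintype.card V : ℝ) - 1) + 2 ≤ (ρ₁ + ρ₂) ^ 2) :
    (Fintype.card V : ℝ) ≤ 2080 * adjForm G (offHub x) (offHub x) := by
  obtain ⟨T₁, e₁, b₁⟩ := hx.exists_sq_eq hG h₁ hρ₁ hdom
  obtain ⟨T₂, e₂, b₂⟩ := hx.exists_sq_eq hG h₂ hρ₂ hdom
  have hM := adjForm_offHub_nonneg G x
  have hs := hx.large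
  have hs0 : 0 < s := by linarith
  set M := adjForm G (offHub x) (offHub x)
  have hc : 520 / s ≤ 1 := by rw [div_le_one hs0]; linarith
  have hcM : 520 / s * M ≤ M := mul_le_of_le_one_left hM hc
  rw [abs_le] at b₁ b₂
  have p₁ := h₁.pos
  have p₂ := h₂.pos
  have t₁ : 0 ≤ T₁ := by
    by_contra! h
    nlinarith [mul_pos_of_neg_of_neg h (neg_neg_of_pos p₁)]
  have t₂ : T₂ ≤ 0 := by
    by_contra! h
    nlinarith [mul_pos h p₂]
  have hle : ρ₂ ≤ ρ₁ := le_of_sq_le_sq (by linarith) p₁.le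
  -- From (ρ₁ + ρ₂)² ≤ 2(ρ₁² + ρ₂²) = 4(n - 1) + 2(T₁ + T₂).
  have hT : 1 ≤ T₁ + T₂ := by nlinarith [sq_nonneg (ρ₁ - ρ₂)]
  have h3 : ρ₂ * (T₁ + T₂) ≤ 2 * (520 / s * M) := by
    nlinarith [mul_le_mul_of_nonneg_right hle t₁]
  have h4 : ρ₂ ≤ 2 * (520 / s * M) := by nlinarith
  have h5 : s * (2 * (520 / s * M)) = 1040 * M := by field_simp; ring
  have h6 := mul_le_mul_of_nonneg_left h4 hs0.le
  rw [h5] at h6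
  rw [← hx.sq_eq]
  nlinarith

theorem IsSpreadExtremal.exists_dominating {k : ℕ} {G : SimpleGraph (Fin (k + 1))}
    (hG : IsSpreadExtremal G) (hk : 10 ^ 14 ≤ k + 1) :
    ∃ x, (∀ v, v ≠ x → G.Adj x v) ∧
      ((k + 1 : ℕ) : ℝ) ≤ 2080 * adjForm G (offHub x) (offHub x) := by
  have hsp := hG.1.isSparse
  set s : ℝ := √((k + 1 : ℕ) : ℝ) with hsdef
  set σ : ℝ := √(k : ℝ) with hσdef
  have hsq : s ^ 2 = ((k + 1 : ℕ) : ℝ) := Real.sq_sqrt (Nat.cast_nonneg _)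
  have hσq : σ ^ 2 = (k : ℝ) := Real.sq_sqrt (Nat.cast_nonneg _)
  have hσ0 : 0 ≤ σ := Real.sqrt_nonneg _
  have hs : 10 ^ 7 ≤ s := by
    refine Real.le_sqrt_of_sq_le ?_
    have h : ((10 : ℝ) ^ 7) ^ 2 = ((10 ^ 14 : ℕ) : ℝ) := by norm_num
    rw [h]
    exact Nat.cast_le.2 hk
  have hs0 : 0 < s := by linarith
  have hcard : s ^ 2 = Fintype.card (Fin (k + 1)) := by rw [hsq, Fintype.card_fin]
  have hσs : s - 1 ≤ σ := by
    refine Real.le_sqrt_of_sq_le ?_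
    push_cast at hsq
    clear hk
    nlinarith
  have hfan := (le_spread_fanGraph (by linarith) hσq).trans (hG.2 _ (isOuterplanar_fanGraph k))
  obtain ⟨ρ₁, ρ₂, hS, h₁, h₂⟩ := exists_topEigenvalues G
  rw [hS] at hfan
  have hσ2 : 0 ≤ 1 / (2 * σ) := by positivity
  have u₁ := h₁.le_add_six (Or.inl rfl) hsp hs0 hcard
  have u₂ := h₂.le_add_six (Or.inr rfl) hsp hs0 hcard
  -- The sum is at least 2(s - 1) and the other eigenvalue is at most s + 6.
  have l₁ : s - 8 ≤ ρ₁ := by linarith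
  have l₂ : s - 8 ≤ ρ₂ := by linarith
  obtain ⟨x, f₁, n₁⟩ := h₁.exists_isNormalizedEigenvector (Or.inl rfl) (by linarith)
  obtain ⟨y, f₂, n₂⟩ := h₂.exists_isNormalizedEigenvector (Or.inr rfl) (by linarith)
  have hx : IsHub G x s := ⟨hs, hcard, n₁.le_realDegree hsp (by linarith) hcard l₁⟩
  have hy : IsHub G y s := ⟨hs, hcard, n₂.le_realDegree hsp (by linarith) hcard l₂⟩
  obtain rfl := hsp.hub_unique hx hy
  have hdom : ∀ v, v ≠ x → G.Adj x v := by
    by_contra! hne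
    obtain ⟨ρ₁', ρ₂', hS', h₁', h₂'⟩ := exists_topEigenvalues (hubClosure G x)
    have := hG.2 _ (hG.1.hubClosure x)
    linarith [hx.lt_of_isTopEigenvalue_hubClosure hsp n₁ l₁ h₁' hne,
      hx.lt_of_isTopEigenvalue_hubClosure hsp n₂ l₂ h₂' hne]
  refine ⟨x, hdom, ?_⟩
  have := hx.card_le_adjForm hsp n₁ n₂ l₁ l₂ hdom ?_
  · rwa [Fintype.card_fin] at this
  rw [Fintype.card_fin]
  push_cast
  have hσp : 0 < σ := by linarith
  have h1 : (2 * σ + 1 / (2 * σ)) ^ 2 ≤ (ρ₁ + ρ₂) ^ 2 :=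
    pow_le_pow_left₀ (by positivity) hfan 2
  have h2 : (2 * σ + 1 / (2 * σ)) ^ 2 = 4 * σ ^ 2 + 2 + (1 / (2 * σ)) ^ 2 := by
    field_simp; ring
  rw [h2, hσq] at h1
  linarith [sq_nonneg (1 / (2 * σ))]

/-! ### Dominating vertices -/

variable {k : ℕ} {G : SimpleGraph (Fin (k + 1))} {x : Fin (k + 1)}

theorem nonempty_iso_join_of_dominating (hdom : ∀ v, v ≠ x → G.Adj x v) :
    Nonempty (G ≃g join (⊤ : SimpleGraph (Fin 1)) (G.comap x.succAbove)) := by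
  have hbij : Function.Bijective (Sum.elim (fun _ : Fin 1 => x) x.succAbove) := by
    refine ⟨?_, fun v => ?_⟩
    · rintro (i | i) (j | j) h
      · rw [Subsingleton.elim i j]
      · exact absurd h (Fin.ne_succAbove x j)
      · exact absurd h (Fin.succAbove_ne x i)
      · rw [Fin.succAbove_right_injective h]
    · rcases eq_or_ne v x with rfl | hv
      · exact ⟨Sum.inl 0, rfl⟩
      · obtain ⟨i, rfl⟩ := Fin.exists_succAbove_eq hv
        exact ⟨Sum.inr i, rfl⟩
  refine ⟨RelIso.symm ⟨Equiv.ofBijective _ hbij, ?_⟩⟩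
  rintro (i | i) (j | j)
  · simp [join, Subsingleton.elim i j]
  · simp [join, hdom _ (Fin.succAbove_ne x j)]
  · simp [join, (hdom _ (Fin.succAbove_ne x i)).symm]
  · simp [join]

theorem IsOuterplanar.isLinearForest_comap_succAbove (h : IsOuterplanar G)
    (hdom : ∀ v, v ≠ x → G.Adj x v) : IsLinearForest (G.comap x.succAbove) := by
  obtain ⟨r, hr, hadj⟩ := h.exists_line_order_link x
  exact isLinearForest_of_line_order (r := fun i => r (x.succAbove i))
    (fun i j hij => Fin.succAbove_right_injective (hr hij)) fun i j hij =>
      hadj _ _ ⟨hij, hdom _ (Fin.succAbove_ne x i), hdom _ (Fin.succAbove_ne x j)⟩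

theorem adjForm_offHub_eq (G : SimpleGraph (Fin (k + 1))) (x : Fin (k + 1)) :
    adjForm G (offHub x) (offHub x) = 2 * ((G.comap x.succAbove).edgeSet.ncard : ℝ) := by
  classical
  have h1 := (G.comap x.succAbove).sum_degrees_eq_twice_card_edges
  rw [Set.ncard_eq_toFinset_card', ← SimpleGraph.edgeFinset]
  have h2 : ((∑ i, (G.comap x.succAbove).degree i : ℕ) : ℝ) =
      2 * ((G.comap x.succAbove).edgeFinset.card : ℝ) := by rw [h1]; push_cast; rfl
  rw [← h2, adjForm, Fin.sum_univ_succAbove _ x]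
  push_cast
  simp only [offHub, if_true, Fin.succAbove_ne, if_false, zero_mul, one_mul, zero_add]
  refine Finset.sum_congr rfl fun i _ => ?_
  rw [neighborSum, Fin.sum_univ_succAbove _ x, ← SimpleGraph.card_neighborFinset_eq_degree,
    SimpleGraph.neighborFinset_eq_filter]
  simp [offHub, Fin.succAbove_ne]

end OuterplanarSpread

theorem theorem1 :
    ∃ c : ℝ, 0 < c ∧ ∃ N : ℕ, ∀ n : ℕ, N ≤ n → ∀ G : SimpleGraph (Fin n),
      OuterplanarSpread.IsSpreadExtremal G →
        ∃ F : SimpleGraph (Fin (n - 1)),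
          OuterplanarSpread.IsLinearForest F ∧
          Nonempty (G ≃g OuterplanarSpread.join (⊤ : SimpleGraph (Fin 1)) F) ∧
          c * (n : ℝ) ≤ (F.edgeSet.ncard : ℝ) := by
  -- 4160 = 2 · 2080, because the form counts every edge twice; n ≥ 10¹⁴ is s ≥ 10⁷.
  refine ⟨1 / 4160, by norm_num, 10 ^ 14, fun n hn G hG => ?_⟩
  obtain ⟨k, rfl⟩ : ∃ k, n = k + 1 := Nat.exists_eq_succ_of_ne_zero (by omega)
  obtain ⟨x, hdom, hM⟩ := hG.exists_dominating hn
  refine ⟨G.comap x.succAbove, hG.1.isLinearForest_comap_succAbove hdom,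
    OuterplanarSpread.nonempty_iso_join_of_dominating hdom, ?_⟩
  rw [OuterplanarSpread.adjForm_offHub_eq] at hM
  change 1 / 4160 * ((k + 1 : ℕ) : ℝ) ≤ ((G.comap x.succAbove).edgeSet.ncard : ℝ)
  linarith
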